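/- Let $K\ge 1$, $b>0$ and $0<\epsilon<1$. For each $n\ge1$ consider a cluster of $m^{(n)}=\lceil bn\rceil$ servers, where server $s$ has capacity $\mu^{(n)}_s\ge 0$, and $Kn$ job classes, partitioned into $K$ parts $I^{(n)}_1,\dots,I^{(n)}_K$ of size $n$; write $I^{(n)}=\bigcup_k I^{(n)}_k$. For $i\in I^{(n)}_k$ the set $\mathbf S^{(n)}_i$ of servers which can process class $i$ is chosen uniformly at random among the sets of $d^{(n)}_k$ servers ($1\le d_k^{(n)}\le m^{(n)}$), independently over the classes. Let $\mathbf M^{(n)}(A)=\sum_{s\in\bigcup_{i\in A}\mathbf S^{(n)}_i}\mu^{(n)}_s$ for $A\subset I^{(n)}$, let $\mu^{(n)}(A)=\mathbb E[\mathbf M^{(n)}(A)]$, and let $\mathcal C^{(n)}$ be the polymatroid with rank function $\mu^{(n)}$; $(1\pm\epsilon)\mathcal C^{(n)}$ is the polymatroid with rank function $(1\pm\epsilon)\mu^{(n)}$. Assume that 1. for each $n$ the servers are partitioned into a number of groups that does not depend on $n$, where each group consists of $\Omega(n)$ servers of the same capacity; 2. $d^{(n)}_k=\omega(\log n)$ for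 each $k=1,\dots,K$. A processor-sharing system with capacity set $\{\phi\in\mathbb R_+^{I}:\sum_{i\in A}\phi_i\le\mu(A)\ \forall A\subset I\}$ has Poisson arrivals of intensity $\lambda_i$ and independent exponential service requirements of mean $\sigma_i$ at queue $i$, hence traffic intensity $\rho_i=\lambda_i\sigma_i$; queue $i$ is served at rate $\phi_i(x)$ in state $x=(x_j)_{j\in I}\in\mathbb N^I$, where $x_j$ is the number of jobs at queue $j$. The allocation $\phi$ is balanced fairness: the only one with $\phi(x)$ in the capacity set and $\phi_i(x)=0$ if $x_i=0$, with $\phi_i(x)\phi_j(x-e_i)=\phi_i(x-e_j)\phi_j(x)$ whenever $x_i,x_j>0$, and with $\sum_{i\in A}\phi_i(x)=\mu(A)$ for some nonempty $A\subset\{i:x_i>0\}$ whenever $x\ne0$. The system is stable if $\sum_{i\in A}\rho_i<\mu(A)$ for all nonempty $A\subset I$. For each $n\ge1$ let all classes of $I^{(n)}_k$ have traffic intensity $\varrho^{(n)}_k\ge0$, for $k=1,\dots,K$, and suppose that the system with capacity set $(1-\epsilon)\mathcal C^{(n)}$ is stable. Let $\pi^{(n)}_{\pm}$ be the stationary distributions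 of the processor-sharing systems with capacity sets $(1\pm\epsilon)\mathcal C^{(n)}$ and these traffic intensities, and let $L^{(n)}_{k,\pm}$ be the corresponding mean total numbers of jobs in the $n$ queues of part $k$. Let $\mathbf L^{(n)}_i$ be the mean stationary number of class-$i$ jobs in the processor-sharing system whose capacity set is given by the realized rank function $\mathbf M^{(n)}$, with $\mathbf L^{(n)}_i=+\infty$ if the realized system is not stable. Then $$ \mathbb P\left\{\frac{\pi^{(n)}_-(0)}{\pi^{(n)}_+(0)}\frac{L^{(n)}_{k,+}}{n}\le \mathbf L^{(n)}_i\le\frac{\pi^{(n)}_+(0)}{\pi^{(n)}_-(0)}\frac{L^{(n)}_{k,-}}{n}\quad\forall k=1,\dots,K,\ \forall i\in I^{(n)}_k\right\}=1-o\left(\frac1n\right). $$ -/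

import Mathlib

open MeasureTheory ProbabilityTheory Filter Asymptotics
open scoped ENNReal

noncomputable section

namespace PolySym

section ProcessorSharing

variable {ι : Type*} [Fintype ι] [DecidableEq ι]

/-- The capacity set `{φ ∈ ℝ₊^ι : ∑_{i ∈ A} φ_i ≤ μ(A) for all A ⊆ ι}` with rank function `μ`. -/
def capacitySet (μ : Finset ι → ℝ) : Set (ι → ℝ) :=
  {r | (∀ i, 0 ≤ r i) ∧ ∀ A : Finset ι, ∑ i ∈ A, r i ≤ μ A}

/-- The set `I(x)` of active queues in state `x`. -/
def active (x : ι → ℕ) : Finset ι := Finset.univ.filter fun i => 0 < x i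

/-- `φ` is the balanced fair allocation in the capacity set with rank function `μ`: it is feasible,
idle queues get no service, it has the balance property, and in every nonempty state the
constraint of some nonempty set of active queues is saturated. -/
structure IsBalancedFair (μ : Finset ι → ℝ) (φ : (ι → ℕ) → ι → ℝ) : Prop where
  feasible : ∀ x, φ x ∈ capacitySet μ
  idle : ∀ x i, x i = 0 → φ x i = 0
  balance : ∀ x i j, 0 < x i → 0 < x j →
    φ x i * φ (x - Pi.single i 1) j = φ (x - Pi.single j 1) i * φ x j
  saturated : ∀ x, x ≠ 0 → ∃ A : Finset ι, A.Nonempty ∧ A ⊆ active x ∧ ∑ i ∈ A, φ x i = μ A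

/-- `p` is a stationary distribution of the Markov jump process on `ι → ℕ` with
transitions `x → x + e_i` at rate `lam i` (Poisson arrivals) and, if `x_i > 0`,
`x → x - e_i` at rate `φ_i(x) / sig i` (exponential service requirements of mean `sig i`):
global balance equations, flow out of `x` = flow into `x`. -/
def IsStationary (lam sig : ι → ℝ) (φ : (ι → ℕ) → ι → ℝ) (p : PMF (ι → ℕ)) : Prop :=
  ∀ x : ι → ℕ,
    (p x).toReal * ∑ i, (lam i + if 0 < x i then φ x i / sig i else 0) =
      ∑ i, ((if 0 < x i then (p (x - Pi.single i 1)).toReal * lam i else 0) +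
        (p (x + Pi.single i 1)).toReal * (φ (x + Pi.single i 1) i / sig i))

/-- `p` is a stationary distribution of the processor-sharing system under balanced fairness in
the capacity set with rank function `μ`. -/
def IsSteadyState (lam sig : ι → ℝ) (μ : Finset ι → ℝ) (p : PMF (ι → ℕ)) : Prop :=
  ∃ φ, IsBalancedFair μ φ ∧ IsStationary lam sig φ p

open Classical in
/-- The stationary distribution of the processor-sharing system with arrival rates `lam`, mean
service requirements `sig` and rank function `μ`, under balanced fairness
(a point mass at `0` in case there is none). -/
def steadyState (lam sig : ι → ℝ) (μ : Finset ι → ℝ) : PMF (ι → ℕ) :=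
  if h : ∃ p, IsSteadyState lam sig μ p then h.choose else PMF.pure 0

/-- `ρ` lies in the interior of the capacity set with rank function `μ` (stability). -/
def Stable (μ : Finset ι → ℝ) (ρ : ι → ℝ) : Prop :=
  ∀ A : Finset ι, A.Nonempty → ∑ i ∈ A, ρ i < μ A

/-- The mean number of jobs at queue `i` when the state has law `p`. -/
def meanJobs (p : PMF (ι → ℕ)) (i : ι) : ℝ≥0∞ := ∑' x, (x i : ℝ≥0∞) * p x

open Classical in
/-- The mean number of jobs at queue `i` in steady state, `+∞` if the system is not stable. -/
def steadyMeanJobs (lam sig : ι → ℝ) (μ : Finset ι → ℝ) (i : ι) : ℝ≥0∞ :=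
  if Stable μ (fun j => lam j * sig j) then meanJobs (steadyState lam sig μ) i else ⊤

end ProcessorSharing

/-- The mean number of jobs in part `k`, that is in all queues `(k, j)`, `j < n`, together. -/
def partMeanJobs {K n : ℕ} (p : PMF (Fin K × Fin n → ℕ)) (k : Fin K) : ℝ≥0∞ :=
  ∑' x, ((∑ j, x (k, j) : ℕ) : ℝ≥0∞) * p x

/-- The rank function of a cluster: `cap s` is the capacity of server `s`, and
`S i` is the set of servers which can serve class `i`. -/
def clusterRank {ι : Type*} {m : ℕ} (cap : Fin m → ℝ) (S : ι → Finset (Fin m))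
    (A : Finset ι) : ℝ :=
  ∑ s ∈ A.biUnion S, cap s

/-- The sets `S i`, `i ∈ ι`, of servers are chosen independently at random, `S i` uniformly among
the subsets of cardinality `d i` of the `m` servers. -/
structure IsRandomAssignment {ι Ω : Type*} [MeasurableSpace Ω] {m : ℕ} (P : Measure Ω)
    (d : ι → ℕ) (S : ι → Ω → Finset (Fin m)) : Prop where
  measurable : ∀ i T, MeasurableSet (S i ⁻¹' {T})
  uniform : ∀ i T, P (S i ⁻¹' {T}) = if T.card = d i then ((m.choose (d i) : ℕ) : ℝ≥0∞)⁻¹ else 0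
  indep : iIndepFun (m := fun _ => ⊤) S P

/-- The mean rank function `μ(A) = 𝔼[M(A)]` of the random cluster. -/
def meanRank {ι Ω : Type*} [MeasurableSpace Ω] {m : ℕ} (P : Measure Ω)
    (cap : Fin m → ℝ) (S : ι → Ω → Finset (Fin m)) (A : Finset ι) : ℝ :=
  ∫ ω, clusterRank cap (fun i => S i ω) A ∂P

/-- The servers are partitioned into a constant number `J` of groups: servers in the same group have
the same capacity, and each group contains `Ω(n)` servers. -/
def ServerGroups (m : ℕ → ℕ) (cap : ∀ n, Fin (m n) → ℝ) : Prop :=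
  ∃ (J : ℕ) (grp : ∀ n, Fin (m n) → Fin J),
    (∀ n, 1 ≤ n → ∀ s t, grp n s = grp n t → cap n s = cap n t) ∧
    ∀ j, (fun n : ℕ => (n : ℝ)) =O[atTop]
      fun n => ((Finset.univ.filter fun s => grp n s = j).card : ℝ)

end PolySym

end

/-!
The proof combines a monotonicity property of balanced fairness with a concentration inequality for
the random rank function.

*Queueing part.* Balanced fairness is given by a balance function `Φ`, with `Φ(0) = 1` and `Φ(x)` the
maximum of `∑_{i ∈ A} Φ(x - e_i) / μ(A)` over the nonempty sets `A` of active queues, through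
`φ_i(x) = Φ(x - e_i) / Φ(x)` (`IsBalanceFunction.isBalancedFair` and, for uniqueness,
`IsBalanceFunction.eq_of_isBalancedFair`). The weights `Φ(x) ∏ ρ_i ^ x_i` are reversible. They are
summable under stability: a stable `ρ` is dominated strictly, coordinate by coordinate, by a point
`r` of the capacity set, and comparison with independent queues of rates `r_i` gives
`Φ(x) ≤ ∏ r_i ^ (-x_i)`. Their normalization is the only stationary distribution, as the absolute
value of a solution of the balance equations is again a solution (`IsStationary.unique`). From the
recursion, `Φ` decreases when the rank function increases (`IsBalanceFunction.anti`). So if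
`(1 - ε) μ ≤ M ≤ (1 + ε) μ`, then the system with rank function `M` is stable and all its weights lie
between those of the two deterministic systems. This yields the bounds for the mean numbers of jobs
(`meanJobs_mem_of_le_of_le`), where the deterministic systems are symmetric within each part
(`partMeanJobs_div`).

*Concentration part.* The inequalities `(1 - ε) μ ≤ M ≤ (1 + ε) μ` have to hold for all sets of classes
at once with probability `1 - o(1 / n)`. It is enough to look at the number of servers of a group `G`
which can serve some class of `A`. The coverages of different servers are negatively dependent: an
increasing function of the coverage of the other servers is larger on average when `s` is not covered
(`prod_mul_assignmentMean_le`, by exchanging servers in the set of one class at a time). Hence the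
number of covered servers obeys the Chernoff bounds of a Poisson variable with the same mean
(`assignmentMean_exp_le`). For the sets `A` such that `|A| log n` is at most a constant times `n`, the
mean is at least a large multiple of `|A| log n` since the degrees are `ω(log n)` and the groups have
`Ω(n)` servers, so that a union bound applies. Larger sets contain such a set which already covers
nearly all servers of `G` (`isNear_of_small`). The exceptional probability is `O(1 / n²)`
(`exists_eventually_measureReal_le`).
-/

namespace PolySym

/-! ### Balance functions -/

theorem mem_active {ι : Type*} [Fintype ι] {x : ι → ℕ} {i : ι} : i ∈ active x ↔ 0 < x i := by simp [active]

theorem sub_single_add_single {ι : Type*} [DecidableEq ι] {x : ι → ℕ} {i : ι} (hi : 0 < x i) :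
    x - Pi.single i 1 + Pi.single i 1 = x := by
  ext j
  by_cases h : j = i
  · subst h; simp; omega
  · simp [h]

theorem exists_pos_of_ne_zero {ι : Type*} {x : ι → ℕ} (hx : x ≠ 0) : ∃ i, 0 < x i := by
  by_contra! h
  exact hx (funext fun i => Nat.le_zero.1 (h i))

section Balance

variable {ι : Type*} [Fintype ι] [DecidableEq ι]

theorem sum_sub_single {x : ι → ℕ} {i : ι} (hi : 0 < x i) :
    ∑ j, (x - Pi.single i 1 : ι → ℕ) j + 1 = ∑ j, x j := by
  conv_rhs => rw [← sub_single_add_single hi]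
  simp [Finset.sum_add_distrib]

/-- Induction on the number of jobs: a property of a state may be deduced from the same property
of the states with one job less. -/
theorem state_induction {p : (ι → ℕ) → Prop}
    (h : ∀ x, (∀ i, 0 < x i → p (x - Pi.single i 1)) → p x) (x : ι → ℕ) : p x := by
  generalize hk : ∑ i, x i = k
  induction k using Nat.strong_induction_on generalizing x with
  | _ k ih =>
    refine h x fun i hi => ih _ ?_ _ rfl
    have := sum_sub_single hi
    omega

/-- `Φ` is the balance function of the rank function `μ`: `Φ(0) = 1` and, for `x ≠ 0`, `Φ(x)` is
the maximum of `∑_{i ∈ A} Φ(x - e_i) / μ(A)` over the nonempty sets `A` of active queues. -/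
structure IsBalanceFunction (μ : Finset ι → ℝ) (Φ : (ι → ℕ) → ℝ) : Prop where
  zero : Φ 0 = 1
  pos : ∀ x, 0 < Φ x
  sum_le : ∀ x, x ≠ 0 → ∀ A : Finset ι, A.Nonempty → A ⊆ active x →
    ∑ i ∈ A, Φ (x - Pi.single i 1) ≤ μ A * Φ x
  sum_eq : ∀ x, x ≠ 0 → ∃ A : Finset ι, A.Nonempty ∧ A ⊆ active x ∧
    ∑ i ∈ A, Φ (x - Pi.single i 1) = μ A * Φ x

/-- The `k`-th iterate of the recursion of the balance function; it is the balance function itself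
in states with at most `k` jobs. The empty set of queues contributes the value `0` to the maximum,
which is harmless. -/
noncomputable def balanceIter (μ : Finset ι → ℝ) : ℕ → (ι → ℕ) → ℝ
  | 0, _ => 1
  | k + 1, x => (active x).powerset.sup' (Finset.powerset_nonempty _)
      fun A => (∑ i ∈ A, balanceIter μ k (x - Pi.single i 1)) / μ A

theorem exists_isBalanceFunction {μ : Finset ι → ℝ} (hμ : ∀ A : Finset ι, A.Nonempty → 0 < μ A) :
    ∃ Φ, IsBalanceFunction μ Φ := by
  set Φ : (ι → ℕ) → ℝ := fun x => balanceIter μ (∑ i, x i) x with hΦ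
  have step : ∀ x : ι → ℕ, x ≠ 0 → Φ x = (active x).powerset.sup' (Finset.powerset_nonempty _)
      fun A => (∑ i ∈ A, Φ (x - Pi.single i 1)) / μ A := by
    intro x hx
    obtain ⟨i, hi⟩ := exists_pos_of_ne_zero hx
    obtain ⟨k, hk⟩ : ∃ k, ∑ i, x i = k + 1 := ⟨_, (sum_sub_single hi).symm⟩
    simp only [hΦ]
    rw [hk, balanceIter]
    refine Finset.sup'_congr _ rfl fun A hA => ?_
    congr 1
    refine Finset.sum_congr rfl fun j hj => ?_
    have h := sum_sub_single (mem_active.1 (Finset.mem_powerset.1 hA hj))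
    rw [show ∑ l, (x - Pi.single j 1 : ι → ℕ) l = k by omega]
  have hzero : Φ 0 = 1 := by simp [hΦ, balanceIter]
  clear_value Φ
  have hpos : ∀ x, 0 < Φ x := by
    refine state_induction fun x ih => ?_
    by_cases hx : x = 0
    · simp [hx, hzero]
    · obtain ⟨i, hi⟩ := exists_pos_of_ne_zero hx
      rw [step x hx, Finset.lt_sup'_iff]
      exact ⟨{i}, by simpa [mem_active] using hi,
        div_pos (by simpa using ih i hi) (hμ _ (Finset.singleton_nonempty i))⟩
  refine ⟨Φ, hzero, hpos, fun x hx A hA hAx => ?_, fun x hx => ?_⟩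
  · rw [mul_comm, ← div_le_iff₀ (hμ A hA), step x hx]
    exact Finset.le_sup' (fun A => (∑ i ∈ A, Φ (x - Pi.single i 1)) / μ A)
      (Finset.mem_powerset.2 hAx)
  · obtain ⟨A, hA, hAx⟩ := Finset.exists_mem_eq_sup' (Finset.powerset_nonempty (active x))
      fun A => (∑ i ∈ A, Φ (x - Pi.single i 1)) / μ A
    rw [← step x hx] at hAx
    have hne : A.Nonempty := by
      rw [Finset.nonempty_iff_ne_empty]
      rintro rfl
      have := hpos x
      simp [hAx] at this
    refine ⟨A, hne, Finset.mem_powerset.1 hA, ?_⟩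
    rw [hAx, mul_div_cancel₀ _ (hμ A hne).ne']

namespace IsBalanceFunction

variable {μ ν : Finset ι → ℝ} {Φ Ψ : (ι → ℕ) → ℝ}

/-- A smaller capacity set has a larger balance function. -/
theorem anti (hΦ : IsBalanceFunction μ Φ) (hΨ : IsBalanceFunction ν Ψ)
    (hν : ∀ A : Finset ι, A.Nonempty → 0 < ν A)
    (h : ∀ A : Finset ι, A.Nonempty → ν A ≤ μ A) (x : ι → ℕ) : Φ x ≤ Ψ x := by
  induction x using state_induction with
  | _ x ih =>
    by_cases hx : x = 0
    · rw [hx, hΦ.zero, hΨ.zero]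
    obtain ⟨A, hA, hAx, hsum⟩ := hΦ.sum_eq x hx
    have h1 : μ A * Φ x ≤ ν A * Ψ x :=
      hsum ▸ (Finset.sum_le_sum fun i hi => ih i (mem_active.1 (hAx hi))).trans
        (hΨ.sum_le x hx A hA hAx)
    have h2 : ν A * Φ x ≤ μ A * Φ x := mul_le_mul_of_nonneg_right (h A hA) (hΦ.pos x).le
    exact le_of_mul_le_mul_left (h2.trans h1) (hν A hA)

theorem unique (hΦ : IsBalanceFunction μ Φ) (hΨ : IsBalanceFunction μ Ψ)
    (hμ : ∀ A : Finset ι, A.Nonempty → 0 < μ A) : Φ = Ψ :=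
  funext fun x => le_antisymm (hΦ.anti hΨ hμ (fun _ _ => le_rfl) x)
    (hΨ.anti hΦ hμ (fun _ _ => le_rfl) x)

theorem comp_perm (hΦ : IsBalanceFunction μ Φ) (σ : Equiv.Perm ι)
    (hσ : ∀ A : Finset ι, μ (A.map σ.toEmbedding) = μ A) :
    IsBalanceFunction μ fun x => Φ (x ∘ σ) := by
  have hsub : ∀ (x : ι → ℕ) i, (x - Pi.single (σ i) 1) ∘ σ = x ∘ σ - Pi.single i 1 := by
    intro x i
    ext j
    by_cases h : j = i
    · subst h; simp
    · simp [h]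
  have hne : ∀ x : ι → ℕ, x ≠ 0 → x ∘ σ ≠ 0 := by
    intro x hx h
    refine hx (funext fun i => ?_)
    simpa using congrFun h (σ.symm i)
  have hsum : ∀ (x : ι → ℕ) (A : Finset ι), ∑ i ∈ A.map σ.toEmbedding,
      Φ ((x - Pi.single i 1) ∘ σ) = ∑ i ∈ A, Φ (x ∘ σ - Pi.single i 1) := by
    intro x A
    simp [Finset.sum_map, hsub]
  refine ⟨?_, fun x => hΦ.pos _, fun x hx A hA hAx => ?_, fun x hx => ?_⟩
  · exact hΦ.zero
  · have hA' : (A.map σ.symm.toEmbedding).map σ.toEmbedding = A := by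
      ext; simp
    rw [← hA', hsum, hσ]
    refine hΦ.sum_le _ (hne x hx) _ (by simpa using hA) fun i hi => ?_
    obtain ⟨j, hj, rfl⟩ := Finset.mem_map.1 hi
    simpa [mem_active] using mem_active.1 (hAx hj)
  · obtain ⟨A, hA, hAx, h⟩ := hΦ.sum_eq _ (hne x hx)
    refine ⟨A.map σ.toEmbedding, by simpa using hA, fun i hi => ?_, by rw [hsum, hσ, h]⟩
    obtain ⟨j, hj, rfl⟩ := Finset.mem_map.1 hi
    simpa [mem_active] using mem_active.1 (hAx hj)

/-- The allocation derived from the balance function is balanced fair. -/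
theorem isBalancedFair (hΦ : IsBalanceFunction μ Φ) (hmono : Monotone μ) (h0 : 0 ≤ μ ∅) :
    IsBalancedFair μ fun x i => if 0 < x i then Φ (x - Pi.single i 1) / Φ x else 0 := by
  refine ⟨fun x => ⟨fun i => ?_, fun A => ?_⟩, fun x i hi => by simp [hi], fun x i j hi hj => ?_,
    fun x hx => ?_⟩
  · dsimp only
    split_ifs
    · exact (div_pos (hΦ.pos _) (hΦ.pos _)).le
    · exact le_rfl
  · rw [← Finset.sum_filter, ← Finset.sum_div]
    refine le_trans ?_ (hmono (Finset.filter_subset (fun i => 0 < x i) A))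
    rcases (A.filter fun i => 0 < x i).eq_empty_or_nonempty with h | h
    · rw [h]; simpa using h0
    · rw [div_le_iff₀ (hΦ.pos x)]
      obtain ⟨i, hi⟩ := h
      refine hΦ.sum_le x ?_ _ ⟨i, hi⟩ fun i hi => mem_active.2 (Finset.mem_filter.1 hi).2
      rintro rfl
      simp at hi
  · by_cases hij : i = j
    · subst hij; ring
    · have hx : x - Pi.single i 1 - Pi.single j 1 = x - Pi.single j 1 - Pi.single i 1 := by
        ext l; simp only [Pi.sub_apply]; omega
      have h1 : 0 < (x - Pi.single i 1 : ι → ℕ) j := by simpa [Ne.symm hij] using hj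
      have h2 : 0 < (x - Pi.single j 1 : ι → ℕ) i := by simpa [hij] using hi
      have := (hΦ.pos (x - Pi.single i 1)).ne'
      have := (hΦ.pos (x - Pi.single j 1)).ne'
      simp only [hi, hj, h1, h2, if_true, hx]
      field_simp
  · obtain ⟨A, hA, hAx, h⟩ := hΦ.sum_eq x hx
    refine ⟨A, hA, hAx, ?_⟩
    rw [Finset.sum_congr rfl fun i hi => if_pos (mem_active.1 (hAx hi)), ← Finset.sum_div, h,
      mul_div_cancel_right₀ _ (hΦ.pos x).ne']

/-- Balanced fairness is unique. -/
theorem eq_of_isBalancedFair (hΦ : IsBalanceFunction μ Φ) {φ : (ι → ℕ) → ι → ℝ}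
    (hφ : IsBalancedFair μ φ) (x : ι → ℕ) :
    ∀ i, 0 < x i → φ x i = Φ (x - Pi.single i 1) / Φ x := by
  induction x using state_induction with
  | _ x ih =>
    intro i₀ hi₀
    have hx : x ≠ 0 := by rintro rfl; simp at hi₀
    -- by the balance property, `φ_i(x)` is proportional to `Φ(x - e_i)`
    obtain ⟨c, hc⟩ : ∃ c, ∀ i, 0 < x i → φ x i = c * Φ (x - Pi.single i 1) := by
      refine ⟨φ x i₀ / Φ (x - Pi.single i₀ 1), fun i hi => ?_⟩
      have p1 := hΦ.pos (x - Pi.single i₀ 1)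
      have p2 := hΦ.pos (x - Pi.single i 1)
      by_cases h : i = i₀
      · subst h; field_simp
      have hb := hφ.balance x i i₀ hi hi₀
      have h1 : 0 < (x - Pi.single i 1 : ι → ℕ) i₀ := by simpa [Ne.symm h] using hi₀
      have h2 : 0 < (x - Pi.single i₀ 1 : ι → ℕ) i := by simpa [h] using hi
      rw [ih i hi i₀ h1, ih i₀ hi₀ i h2] at hb
      have hs : x - Pi.single i 1 - Pi.single i₀ 1 = x - Pi.single i₀ 1 - Pi.single i 1 := by
        ext l; simp only [Pi.sub_apply]; omega
      rw [hs] at hb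
      have p3 := hΦ.pos (x - Pi.single i₀ 1 - Pi.single i 1)
      field_simp at hb ⊢
      linarith
    -- the constant is determined by feasibility and saturation
    have hsum : ∀ A ⊆ active x, ∑ i ∈ A, φ x i = c * ∑ i ∈ A, Φ (x - Pi.single i 1) :=
      fun A hA => by
        rw [Finset.mul_sum]
        exact Finset.sum_congr rfl fun i hi => hc i (mem_active.1 (hA hi))
    have hspos : ∀ A : Finset ι, A.Nonempty → 0 < ∑ i ∈ A, Φ (x - Pi.single i 1) :=
      fun A hA => Finset.sum_pos (fun i _ => hΦ.pos _) hA
    have h1 : c * Φ x ≤ 1 := by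
      obtain ⟨A, hA, hAx, h⟩ := hΦ.sum_eq x hx
      have hf := (hφ.feasible x).2 A
      rw [hsum A hAx] at hf
      have := mul_le_mul_of_nonneg_right hf (hΦ.pos x).le
      rw [← h] at this
      nlinarith [hspos A hA]
    have h2 : 1 ≤ c * Φ x := by
      obtain ⟨A, hA, hAx, h⟩ := hφ.saturated x hx
      have hf := hΦ.sum_le x hx A hA hAx
      rw [← h, hsum A hAx] at hf
      nlinarith [hspos A hA]
    have hcx : c * Φ x = 1 := le_antisymm h1 h2
    rw [hc i₀ hi₀, eq_div_iff (hΦ.pos x).ne', mul_right_comm, hcx, one_mul]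

end IsBalanceFunction

/-- For the capacity set of independent queues of rates `r_i`, the balance function is a product
of powers. -/
theorem isBalanceFunction_prod {r : ι → ℝ} (hr : ∀ i, 0 < r i) :
    IsBalanceFunction (fun A => ∑ i ∈ A, r i) fun x => ∏ i, (r i)⁻¹ ^ x i := by
  have key : ∀ (x : ι → ℕ) i, 0 < x i →
      ∏ j, (r j)⁻¹ ^ (x - Pi.single i 1 : ι → ℕ) j = r i * ∏ j, (r j)⁻¹ ^ x j := by
    intro x i hi
    conv_rhs => rw [← sub_single_add_single hi]
    simp only [Pi.add_apply, pow_add, Finset.prod_mul_distrib]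
    have : ∏ j, (r j)⁻¹ ^ (Pi.single i 1 : ι → ℕ) j = (r i)⁻¹ := by
      rw [Finset.prod_eq_single i] <;> simp +contextual
    rw [this, mul_comm, mul_assoc, inv_mul_cancel₀ (hr i).ne', mul_one]
  have hsum : ∀ (x : ι → ℕ) (A : Finset ι), A ⊆ active x →
      ∑ i ∈ A, ∏ j, (r j)⁻¹ ^ (x - Pi.single i 1 : ι → ℕ) j = (∑ i ∈ A, r i) * ∏ j, (r j)⁻¹ ^ x j := by
    intro x A hA
    rw [Finset.sum_mul]
    exact Finset.sum_congr rfl fun i hi => key x i (mem_active.1 (hA hi))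
  refine ⟨by simp, fun x => Finset.prod_pos fun i _ => pow_pos (inv_pos.2 (hr i)) _,
    fun x _ A _ hA => (hsum x A hA).le, fun x hx => ?_⟩
  obtain ⟨i, hi⟩ := exists_pos_of_ne_zero hx
  exact ⟨active x, ⟨i, mem_active.2 hi⟩, subset_rfl, hsum x _ subset_rfl⟩

theorem summable_prod_pow {q : ι → ℝ} (h0 : ∀ i, 0 ≤ q i) (h1 : ∀ i, q i < 1) :
    Summable fun x : ι → ℕ => ∏ i, q i ^ x i := by
  refine summable_of_sum_le (c := ∏ i, (1 - q i)⁻¹)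
    (fun x => Finset.prod_nonneg fun i _ => pow_nonneg (h0 i) _) fun s => ?_
  have hs : s ⊆ Fintype.piFinset fun _ : ι => Finset.range (s.sup (fun x => ∑ i, x i) + 1) := by
    intro x hx
    rw [Fintype.mem_piFinset]
    intro i
    have h2 := Finset.le_sup (f := fun x : ι → ℕ => ∑ i, x i) hx
    have h3 := Finset.single_le_sum (f := x) (fun _ _ => Nat.zero_le _) (Finset.mem_univ i)
    exact Finset.mem_range.2 (Nat.lt_succ_of_le (h3.trans h2))
  refine (Finset.sum_le_sum_of_subset_of_nonneg hs fun x _ _ =>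
    Finset.prod_nonneg fun i _ => pow_nonneg (h0 i) _).trans ?_
  rw [← Finset.prod_univ_sum]
  refine Finset.prod_le_prod (fun i _ => Finset.sum_nonneg fun k _ => pow_nonneg (h0 i) k)
    fun i _ => ?_
  rw [← tsum_geometric_of_lt_one (h0 i) (h1 i)]
  exact (summable_geometric_of_lt_one (h0 i) (h1 i)).sum_le_tsum _ fun k _ => pow_nonneg (h0 i) k

/-- Under stability, the balance function is dominated by that of independent queues with rates
slightly above the traffic intensities; these are feasible since `ρ` is an interior point. -/
theorem IsBalanceFunction.summable {μ : Finset ι → ℝ} {Φ : (ι → ℕ) → ℝ}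
    (hΦ : IsBalanceFunction μ Φ) {ρ : ι → ℝ} (hρ : ∀ i, 0 ≤ ρ i) (hst : Stable μ ρ) :
    Summable fun x => Φ x * ∏ i, ρ i ^ x i := by
  obtain ⟨δ, hδ, hδμ⟩ : ∃ δ > 0, ∀ A : Finset ι, A.Nonempty →
      ∑ i ∈ A, (ρ i + δ) ≤ μ A := by
    have h : ∀ A : Finset ι, ∀ᶠ δ in nhdsWithin (0 : ℝ) (Set.Ioi 0),
        A.Nonempty → ∑ i ∈ A, (ρ i + δ) ≤ μ A := by
      intro A
      by_cases hA : A.Nonempty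
      · have hc : ContinuousAt (fun δ : ℝ => ∑ i ∈ A, (ρ i + δ)) 0 := by fun_prop
        have h2 := hc.eventually_lt (continuousAt_const (y := μ A)) (by simpa using hst A hA)
        filter_upwards [h2.filter_mono nhdsWithin_le_nhds] with δ h _ using h.le
      · exact Eventually.of_forall fun δ h => absurd h hA
    obtain ⟨δ, h1, h2⟩ := ((eventually_all.2 h).and self_mem_nhdsWithin).exists
    exact ⟨δ, h2, h1⟩
  have hr : ∀ i, 0 < ρ i + δ := fun i => add_pos_of_nonneg_of_pos (hρ i) hδ
  have hle := hΦ.anti (isBalanceFunction_prod hr)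
    (fun A hA => Finset.sum_pos (fun i _ => hr i) hA) hδμ
  refine Summable.of_nonneg_of_le (fun x => mul_nonneg (hΦ.pos x).le
    (Finset.prod_nonneg fun i _ => pow_nonneg (hρ i) _)) (fun x => ?_)
    (summable_prod_pow (q := fun i => ρ i / (ρ i + δ)) (fun i => div_nonneg (hρ i) (hr i).le)
      fun i => (div_lt_one (hr i)).2 (by linarith))
  calc Φ x * ∏ i, ρ i ^ x i ≤ (∏ i, (ρ i + δ)⁻¹ ^ x i) * ∏ i, ρ i ^ x i :=
        mul_le_mul_of_nonneg_right (hle x) (Finset.prod_nonneg fun i _ => pow_nonneg (hρ i) _)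
    _ = ∏ i, (ρ i / (ρ i + δ)) ^ x i := by
        rw [← Finset.prod_mul_distrib]
        exact Finset.prod_congr rfl fun i _ => by rw [← mul_pow, div_eq_inv_mul]

end Balance

section Stationary

variable {ι : Type*} [Fintype ι] [DecidableEq ι]

/-! ### Stationary distributions -/

theorem hasSum_add_single_iff {ι : Type*} [DecidableEq ι] (i : ι) (g : (ι → ℕ) → ℝ) (a : ℝ) :
    HasSum (fun x : ι → ℕ => g (x + Pi.single i 1)) a ↔ HasSum (fun x => if 0 < x i then g x else 0) a := by
  have hinj : Function.Injective fun x : ι → ℕ => x + Pi.single i 1 := add_left_injective _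
  rw [← hinj.hasSum_iff (f := fun x => if 0 < x i then g x else 0)]
  · simp [Function.comp_def]
  · intro x hx
    refine if_neg fun h => hx ⟨x - Pi.single i 1, sub_single_add_single h⟩

/-- Global balance equations, with birth rates `lam` and death rates `β`, for a signed mass `D`
on the states. -/
def IsGlobalBalance (lam : ι → ℝ) (β : (ι → ℕ) → ι → ℝ) (D : (ι → ℕ) → ℝ) : Prop :=
  ∀ x, D x * ∑ i, (lam i + if 0 < x i then β x i else 0) =
    ∑ i, ((if 0 < x i then D (x - Pi.single i 1) * lam i else 0) +
      D (x + Pi.single i 1) * β (x + Pi.single i 1) i)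

/-- The absolute value of a solution of the balance equations is subinvariant, and since the total
flow into all states is the total flow out of all states, it is invariant. -/
theorem IsGlobalBalance.abs {lam : ι → ℝ} {β : (ι → ℕ) → ι → ℝ} {D : (ι → ℕ) → ℝ}
    (h : IsGlobalBalance lam β D) (hlam : ∀ i, 0 ≤ lam i) (hβ : ∀ x i, 0 ≤ β x i)
    {B : ι → ℝ} (hB : ∀ x i, β x i ≤ B i) (hD : Summable D) :
    IsGlobalBalance lam β fun x => |D x| := by
  have hout : ∀ i, Summable fun x => |D x| * lam i := fun i => hD.abs.mul_right _
  have hout' : ∀ i, Summable fun x => if 0 < x i then |D x| * β x i else 0 := by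
    intro i
    refine Summable.of_nonneg_of_le (fun x => ?_) (fun x => ?_) (hD.abs.mul_right (B i))
    · split_ifs
      exacts [mul_nonneg (abs_nonneg _) (hβ _ _), le_rfl]
    · split_ifs
      exacts [mul_le_mul_of_nonneg_left (hB x i) (abs_nonneg _),
        mul_nonneg (abs_nonneg _) ((hβ x i).trans (hB x i))]
  have h1 : HasSum (fun x => |D x| * ∑ i, (lam i + if 0 < x i then β x i else 0))
      (∑ i, (∑' x, |D x| * lam i + ∑' x, if 0 < x i then |D x| * β x i else 0)) := by
    convert hasSum_sum fun i (_ : i ∈ Finset.univ) => (hout i).hasSum.add (hout' i).hasSum using 2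
      with x
    rw [Finset.mul_sum]
    refine Finset.sum_congr rfl fun i _ => ?_
    split_ifs <;> ring
  have h2 : HasSum (fun x : ι → ℕ => ∑ i, ((if 0 < x i then |D (x - Pi.single i 1)| * lam i else 0) +
      |D (x + Pi.single i 1)| * β (x + Pi.single i 1) i))
      (∑ i, (∑' x, |D x| * lam i + ∑' x, if 0 < x i then |D x| * β x i else 0)) := by
    refine hasSum_sum fun i _ => HasSum.add ?_ ?_
    · refine (hasSum_add_single_iff i (fun x => |D (x - Pi.single i 1)| * lam i) _).1 ?_
      simpa using (hout i).hasSum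
    · rw [hasSum_add_single_iff i fun x => |D x| * β x i]
      exact (hout' i).hasSum
  have hle : ∀ x, |D x| * ∑ i, (lam i + if 0 < x i then β x i else 0) ≤
      ∑ i, ((if 0 < x i then |D (x - Pi.single i 1)| * lam i else 0) +
      |D (x + Pi.single i 1)| * β (x + Pi.single i 1) i) := by
    intro x
    have hQ : 0 ≤ ∑ i, (lam i + if 0 < x i then β x i else 0) :=
      Finset.sum_nonneg fun i _ => add_nonneg (hlam i) (by split_ifs; exacts [hβ x i, le_rfl])
    rw [← abs_of_nonneg hQ, ← abs_mul, h x]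
    refine (Finset.abs_sum_le_sum_abs _ _).trans (Finset.sum_le_sum fun i _ => ?_)
    refine (abs_add_le _ _).trans (add_le_add ?_ ?_)
    · split_ifs
      · rw [abs_mul, abs_of_nonneg (hlam i)]
      · simp
    · rw [abs_mul, abs_of_nonneg (hβ _ i)]
  have h3 := h2.sub h1
  rw [sub_self, hasSum_zero_iff_of_nonneg fun x => sub_nonneg.2 (hle x)] at h3
  intro x
  exact (sub_eq_zero.1 (congrFun h3 x)).symm

/-- A nonnegative solution of the balance equations which vanishes in the empty state vanishes,
since every state leads to the empty state. -/
theorem IsGlobalBalance.eq_zero {lam : ι → ℝ} {β : (ι → ℕ) → ι → ℝ} {D : (ι → ℕ) → ℝ}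
    (h : IsGlobalBalance lam β D) (hlam : ∀ i, 0 ≤ lam i) (hβ : ∀ x i, 0 ≤ β x i)
    (hpos : ∀ x i, 0 < x i → 0 < β x i) (hD : ∀ x, 0 ≤ D x) (h0 : D 0 = 0) (x : ι → ℕ) :
    D x = 0 := by
  induction x using state_induction with
  | _ x ih =>
    by_cases hx : x = 0
    · rw [hx, h0]
    obtain ⟨i, hi⟩ := exists_pos_of_ne_zero hx
    have hb := h (x - Pi.single i 1)
    rw [ih i hi, zero_mul, eq_comm, Finset.sum_eq_zero_iff_of_nonneg] at hb
    · have h1 := hb i (Finset.mem_univ i)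
      have h2 : 0 ≤ if 0 < (x - Pi.single i 1 : ι → ℕ) i then
          D (x - Pi.single i 1 - Pi.single i 1) * lam i else 0 := by
        split_ifs
        exacts [mul_nonneg (hD _) (hlam i), le_rfl]
      rw [sub_single_add_single hi] at h1
      have h3 := hpos x i hi
      have h4 := mul_nonneg (hD x) h3.le
      have h5 : D x * β x i = 0 := by linarith
      exact (mul_eq_zero.1 h5).resolve_right h3.ne'
    · intro j _
      refine add_nonneg ?_ (mul_nonneg (hD _) (hβ _ j))
      split_ifs
      exacts [mul_nonneg (hD _) (hlam j), le_rfl]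

/-- The stationary distribution is unique: the positive part of the difference of two of them, or
of its opposite, vanishes in the empty state, hence everywhere. -/
theorem IsStationary.unique {lam sig : ι → ℝ} {φ : (ι → ℕ) → ι → ℝ} {p q : PMF (ι → ℕ)}
    (hp : IsStationary lam sig φ p) (hq : IsStationary lam sig φ q) (hlam : ∀ i, 0 ≤ lam i)
    (hsig : ∀ i, 0 < sig i) (hφ : ∀ x i, 0 ≤ φ x i) (hpos : ∀ x i, 0 < x i → 0 < φ x i)
    {B : ι → ℝ} (hB : ∀ x i, φ x i ≤ B i) : p = q := by
  have hsum : ∀ r : PMF (ι → ℕ), HasSum (fun x => (r x).toReal) 1 := by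
    intro r
    have := (ENNReal.hasSum_toReal (f := r) (by simp [r.tsum_coe]))
    rwa [← ENNReal.tsum_toReal_eq r.apply_ne_top, r.tsum_coe, ENNReal.toReal_one] at this
  -- the argument for the case in which `p` does not exceed `q` in the empty state
  have key : ∀ p q : PMF (ι → ℕ), IsStationary lam sig φ p → IsStationary lam sig φ q →
      (p 0).toReal ≤ (q 0).toReal → p = q := by
    intro p q hp hq h0
    set D : (ι → ℕ) → ℝ := fun x => (p x).toReal - (q x).toReal with hDdef
    have hD : IsGlobalBalance lam (fun x i => φ x i / sig i) D := by
      intro x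
      have e1 := hp x
      have e2 := hq x
      simp only [hDdef, sub_mul]
      rw [e1, e2, ← Finset.sum_sub_distrib]
      refine Finset.sum_congr rfl fun i _ => ?_
      split_ifs <;> ring
    have hβ : ∀ x i, 0 ≤ φ x i / sig i := fun x i => div_nonneg (hφ x i) (hsig i).le
    have hDs : HasSum D 0 := by simpa using (hsum p).sub (hsum q)
    have habs := hD.abs hlam hβ (B := fun i => B i / sig i)
      (fun x i => div_le_div_of_nonneg_right (hB x i) (hsig i).le) hDs.summable
    have hplus : IsGlobalBalance lam (fun x i => φ x i / sig i) fun x => |D x| + D x := by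
      intro x
      simp only [add_mul]
      rw [hD x, habs x, ← Finset.sum_add_distrib]
      refine Finset.sum_congr rfl fun i _ => ?_
      split_ifs <;> ring
    have hz := hplus.eq_zero hlam hβ (fun x i hi => div_pos (hpos x i hi) (hsig i))
      (fun x => by linarith [neg_abs_le (D x)]) (by
        simp only [hDdef]
        rw [abs_of_nonpos (by linarith)]; ring)
    have hneg : ∀ x, 0 ≤ -D x := fun x => by linarith [hz x, abs_nonneg (D x)]
    have h1 := hDs.neg
    rw [neg_zero, hasSum_zero_iff_of_nonneg hneg] at h1
    ext x
    have h2 : -D x = 0 := congrFun h1 x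
    exact (ENNReal.toReal_eq_toReal_iff' (p.apply_ne_top x) (q.apply_ne_top x)).1
      (by simp only [hDdef] at h2; linarith)
  rcases le_total (p 0).toReal (q 0).toReal with h | h
  exacts [key p q hp hq h, (key q p hq hp h).symm]

/-- The weight `Φ(x) ∏ ρ_i ^ x_i` of the state `x`; the stationary distribution is the
normalization of these weights. -/
noncomputable def weight (Φ : (ι → ℕ) → ℝ) (ρ : ι → ℝ) (x : ι → ℕ) : ℝ≥0∞ :=
  ENNReal.ofReal (Φ x * ∏ i, ρ i ^ x i)

variable {μ : Finset ι → ℝ} {Φ : (ι → ℕ) → ℝ}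

theorem IsBalanceFunction.weight_zero (hΦ : IsBalanceFunction μ Φ) (ρ : ι → ℝ) :
    weight Φ ρ 0 = 1 := by
  simp [weight, hΦ.zero]

theorem IsBalanceFunction.tsum_weight_ne_zero (hΦ : IsBalanceFunction μ Φ) (ρ : ι → ℝ) :
    ∑' x, weight Φ ρ x ≠ 0 := by
  intro h
  have := ENNReal.tsum_eq_zero.1 h 0
  simp [hΦ.weight_zero] at this

theorem IsBalanceFunction.tsum_weight_ne_top (hΦ : IsBalanceFunction μ Φ) {ρ : ι → ℝ}
    (hρ : ∀ i, 0 ≤ ρ i) (hst : Stable μ ρ) : ∑' x, weight Φ ρ x ≠ ⊤ :=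
  (hΦ.summable hρ hst).tsum_ofReal_ne_top

/-- The normalized weights are reversible for balanced fairness. -/
theorem IsBalanceFunction.isSteadyState (hΦ : IsBalanceFunction μ Φ) (hmono : Monotone μ)
    (h0 : 0 ≤ μ ∅) {lam sig : ι → ℝ} (hlam : ∀ i, 0 ≤ lam i) (hsig : ∀ i, 0 < sig i)
    (hst : Stable μ fun i => lam i * sig i) :
    IsSteadyState lam sig μ (PMF.normalize (weight Φ fun i => lam i * sig i)
      (hΦ.tsum_weight_ne_zero _)
      (hΦ.tsum_weight_ne_top (fun i => mul_nonneg (hlam i) (hsig i).le) hst)) := by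
  refine ⟨_, hΦ.isBalancedFair hmono h0, ?_⟩
  set Z := (∑' x, weight Φ (fun i => lam i * sig i) x)⁻¹.toReal
  have hw : ∀ x, (PMF.normalize (weight Φ fun i => lam i * sig i)
      (hΦ.tsum_weight_ne_zero _)
      (hΦ.tsum_weight_ne_top (fun i => mul_nonneg (hlam i) (hsig i).le) hst) x).toReal =
      Φ x * (∏ i, (lam i * sig i) ^ x i) * Z := by
    intro x
    rw [PMF.normalize_apply, ENNReal.toReal_mul, weight, ENNReal.toReal_ofReal]
    exact mul_nonneg (hΦ.pos x).le
      (Finset.prod_nonneg fun i _ => pow_nonneg (mul_nonneg (hlam i) (hsig i).le) _)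
  -- detailed balance between `x` and `x + e_i`
  have hprod : ∀ (x : ι → ℕ) i, ∏ j, (lam j * sig j) ^ (x + Pi.single i 1 : ι → ℕ) j =
      (∏ j, (lam j * sig j) ^ x j) * (lam i * sig i) := by
    intro x i
    simp only [Pi.add_apply, pow_add, Finset.prod_mul_distrib]
    congr 1
    rw [Finset.prod_eq_single i] <;> simp +contextual
  intro x
  rw [Finset.mul_sum]
  refine Finset.sum_congr rfl fun i _ => ?_
  rw [hw, hw, hw, hprod]
  have h1 : (if 0 < (x + Pi.single i 1 : ι → ℕ) i then
      Φ (x + Pi.single i 1 - Pi.single i 1) / Φ (x + Pi.single i 1) else 0) =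
      Φ x / Φ (x + Pi.single i 1) := by simp
  have hs := (hsig i).ne'
  have hp := (hΦ.pos (x + Pi.single i 1)).ne'
  have hx := (hΦ.pos x).ne'
  dsimp only
  rw [h1]
  by_cases hi : 0 < x i
  · have h2 := hprod (x - Pi.single i 1) i
    rw [sub_single_add_single hi] at h2
    simp only [hi, if_true]
    rw [h2]
    field_simp
    ring
  · simp only [hi, if_false]
    field_simp
    ring

/-- Under stability, the stationary distribution is given by the normalized weights. -/
theorem IsBalanceFunction.steadyState_apply (hΦ : IsBalanceFunction μ Φ) (hmono : Monotone μ)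
    (h0 : 0 ≤ μ ∅) {lam sig : ι → ℝ} (hlam : ∀ i, 0 ≤ lam i) (hsig : ∀ i, 0 < sig i)
    (hst : Stable μ fun i => lam i * sig i) (x : ι → ℕ) :
    steadyState lam sig μ x =
      weight Φ (fun i => lam i * sig i) x / ∑' y, weight Φ (fun i => lam i * sig i) y := by
  have hex := hΦ.isSteadyState hmono h0 hlam hsig hst
  have hss : steadyState lam sig μ = PMF.normalize (weight Φ fun i => lam i * sig i)
      (hΦ.tsum_weight_ne_zero _)
      (hΦ.tsum_weight_ne_top (fun i => mul_nonneg (hlam i) (hsig i).le) hst) := by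
    rw [steadyState, dif_pos ⟨_, hex⟩]
    obtain ⟨φ, hφ, hs⟩ := Exists.choose_spec (p := fun p => IsSteadyState lam sig μ p) ⟨_, hex⟩
    obtain ⟨ψ, hψ, ht⟩ := hex
    -- both allocations are balanced fair, so they agree
    have hval : ∀ χ, IsBalancedFair μ χ → ∀ x i, χ x i =
        if 0 < x i then Φ (x - Pi.single i 1) / Φ x else 0 := by
      intro χ hχ x i
      split_ifs with h
      · exact hΦ.eq_of_isBalancedFair hχ x i h
      · exact hχ.idle x i (by omega)
    have hφψ : φ = ψ := by
      funext x i
      rw [hval φ hφ, hval ψ hψ]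
    refine hs.unique (hφψ ▸ ht) hlam hsig (fun x i => (hφ.feasible x).1 i)
      (fun x i hi => ?_) (B := fun i => μ {i}) fun x i => ?_
    · rw [hΦ.eq_of_isBalancedFair hφ x i hi]
      exact div_pos (hΦ.pos _) (hΦ.pos _)
    · simpa using (hφ.feasible x).2 {i}
  rw [hss, PMF.normalize_apply, ENNReal.div_eq_inv_mul, mul_comm]

end Stationary

/-! ### Comparison of systems -/

theorem Stable.pos {ι : Type*} {μ : Finset ι → ℝ} {ρ : ι → ℝ} (h : Stable μ ρ) (hρ : ∀ i, 0 ≤ ρ i)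
    (A : Finset ι) (hA : A.Nonempty) : 0 < μ A :=
  (Finset.sum_nonneg fun i _ => hρ i).trans_lt (h A hA)

theorem Stable.mono {ι : Type*} {μ ν : Finset ι → ℝ} {ρ : ι → ℝ} (h : Stable μ ρ)
    (hν : ∀ A, μ A ≤ ν A) : Stable ν ρ :=
  fun A hA => (h A hA).trans_le (hν A)

theorem meanJobs_eq {ι : Type*} {p : PMF (ι → ℕ)} {w : (ι → ℕ) → ℝ≥0∞} (h : ∀ x, p x = w x / ∑' y, w y)
    (i : ι) : meanJobs p i = (∑' x, (x i : ℝ≥0∞) * w x) / ∑' y, w y := by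
  simp only [meanJobs, h, ENNReal.div_eq_inv_mul, ← ENNReal.tsum_mul_left]
  exact tsum_congr fun x => by ring

section Comparison

variable {ι : Type*} [Fintype ι] [DecidableEq ι]

/-- The properties of rank functions which the existence of balanced fairness depends on;
submodularity is not among them. -/
structure IsRank (μ : Finset ι → ℝ) : Prop where
  mono : Monotone μ
  empty : 0 ≤ μ ∅

theorem weight_le_weight {μ ν : Finset ι → ℝ} {Φ Ψ : (ι → ℕ) → ℝ} {ρ : ι → ℝ}
    (hΨ : IsBalanceFunction ν Ψ) (hΦ : IsBalanceFunction μ Φ)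
    (hpos : ∀ A : Finset ι, A.Nonempty → 0 < μ A) (hle : ∀ A, μ A ≤ ν A) (hρ : ∀ i, 0 ≤ ρ i)
    (x : ι → ℕ) : weight Ψ ρ x ≤ weight Φ ρ x :=
  ENNReal.ofReal_le_ofReal (mul_le_mul_of_nonneg_right (hΨ.anti hΦ hpos (fun A _ => hle A) x)
    (Finset.prod_nonneg fun i _ => pow_nonneg (hρ i) _))

/-- For ordered rank functions, the ratio of the probabilities of the empty state controls the ratio
of the mean numbers of jobs. -/
theorem meanJobs_le {μ ν : Finset ι → ℝ} (hμ : IsRank μ) (hν : IsRank ν)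
    (hle : ∀ A, μ A ≤ ν A) {lam sig : ι → ℝ} (hlam : ∀ i, 0 ≤ lam i) (hsig : ∀ i, 0 < sig i)
    (hst : Stable μ fun i => lam i * sig i) (i : ι) :
    steadyState lam sig μ 0 * meanJobs (steadyState lam sig ν) i ≤
      steadyState lam sig ν 0 * meanJobs (steadyState lam sig μ) i := by
  have hρ : ∀ i, 0 ≤ lam i * sig i := fun i => mul_nonneg (hlam i) (hsig i).le
  have hst' := hst.mono hle
  obtain ⟨Φ, hΦ⟩ := exists_isBalanceFunction (hst.pos hρ)
  obtain ⟨Ψ, hΨ⟩ := exists_isBalanceFunction (hst'.pos hρ)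
  have h1 := hΦ.steadyState_apply hμ.mono hμ.empty hlam hsig hst
  have h2 := hΨ.steadyState_apply hν.mono hν.empty hlam hsig hst'
  rw [meanJobs_eq h1, meanJobs_eq h2, h1, h2, hΦ.weight_zero, hΨ.weight_zero]
  simp only [ENNReal.div_eq_inv_mul, mul_one]
  rw [mul_left_comm]
  gcongr with x
  exact weight_le_weight hΨ hΦ (hst.pos hρ) hle hρ x

theorem steadyState_zero_ne_zero {μ : Finset ι → ℝ} (hμ : IsRank μ) {lam sig : ι → ℝ}
    (hlam : ∀ i, 0 ≤ lam i) (hsig : ∀ i, 0 < sig i)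
    (hst : Stable μ fun i => lam i * sig i) : steadyState lam sig μ 0 ≠ 0 := by
  have hρ : ∀ i, 0 ≤ lam i * sig i := fun i => mul_nonneg (hlam i) (hsig i).le
  obtain ⟨Φ, hΦ⟩ := exists_isBalanceFunction (hst.pos hρ)
  rw [hΦ.steadyState_apply hμ.mono hμ.empty hlam hsig hst, hΦ.weight_zero]
  exact ENNReal.div_ne_zero.2 ⟨one_ne_zero, hΦ.tsum_weight_ne_top hρ hst⟩

theorem steadyState_zero_le {μ ν : Finset ι → ℝ} (hμ : IsRank μ) (hν : IsRank ν)
    (hle : ∀ A, μ A ≤ ν A) {lam sig : ι → ℝ} (hlam : ∀ i, 0 ≤ lam i) (hsig : ∀ i, 0 < sig i)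
    (hst : Stable μ fun i => lam i * sig i) :
    steadyState lam sig μ 0 ≤ steadyState lam sig ν 0 := by
  have hρ : ∀ i, 0 ≤ lam i * sig i := fun i => mul_nonneg (hlam i) (hsig i).le
  have hst' := hst.mono hle
  obtain ⟨Φ, hΦ⟩ := exists_isBalanceFunction (hst.pos hρ)
  obtain ⟨Ψ, hΨ⟩ := exists_isBalanceFunction (hst'.pos hρ)
  rw [hΦ.steadyState_apply hμ.mono hμ.empty hlam hsig hst, hΦ.weight_zero,
    hΨ.steadyState_apply hν.mono hν.empty hlam hsig hst', hΨ.weight_zero]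
  exact ENNReal.div_le_div_left (ENNReal.tsum_le_tsum fun x =>
    weight_le_weight hΨ hΦ (hst.pos hρ) hle hρ x) 1

theorem div_mul_le_of_mul_le_mul {a b c e : ℝ≥0∞} (hb : b ≠ 0) (hb' : b ≠ ⊤)
    (h : a * c ≤ b * e) : a / b * c ≤ e := by
  rw [ENNReal.div_eq_inv_mul, mul_assoc]
  calc b⁻¹ * (a * c) ≤ b⁻¹ * (b * e) := by gcongr
    _ = e := by rw [← mul_assoc, ENNReal.inv_mul_cancel hb hb', one_mul]

theorem le_div_mul_of_mul_le_mul {a b c e : ℝ≥0∞} (hb : b ≠ 0) (hb' : b ≠ ⊤)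
    (h : b * e ≤ a * c) : e ≤ a / b * c := by
  rw [ENNReal.div_eq_inv_mul, mul_assoc]
  calc e = b⁻¹ * (b * e) := by rw [← mul_assoc, ENNReal.inv_mul_cancel hb hb', one_mul]
    _ ≤ b⁻¹ * (a * c) := by gcongr

/-- The mean number of jobs in a system lying between two others. -/
theorem meanJobs_mem_of_le_of_le {κ μ ν : Finset ι → ℝ} (hκ : IsRank κ) (hμ : IsRank μ)
    (hν : IsRank ν) (h1 : ∀ A, κ A ≤ μ A) (h2 : ∀ A, μ A ≤ ν A) {lam sig : ι → ℝ}
    (hlam : ∀ i, 0 ≤ lam i) (hsig : ∀ i, 0 < sig i)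
    (hst : Stable κ fun i => lam i * sig i) (i : ι) :
    steadyState lam sig κ 0 / steadyState lam sig ν 0 * meanJobs (steadyState lam sig ν) i ≤
        meanJobs (steadyState lam sig μ) i ∧
      meanJobs (steadyState lam sig μ) i ≤
        steadyState lam sig ν 0 / steadyState lam sig κ 0 *
          meanJobs (steadyState lam sig κ) i := by
  have hst1 := hst.mono h1
  have hst2 := hst1.mono h2
  constructor
  · refine div_mul_le_of_mul_le_mul (steadyState_zero_ne_zero hν hlam hsig hst2)
      (PMF.apply_ne_top _ _) (le_trans ?_ (meanJobs_le hμ hν h2 hlam hsig hst1 i))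
    gcongr
    exact steadyState_zero_le hκ hμ h1 hlam hsig hst
  · refine le_div_mul_of_mul_le_mul (steadyState_zero_ne_zero hκ hlam hsig hst)
      (PMF.apply_ne_top _ _) ((meanJobs_le hκ hμ h1 hlam hsig hst i).trans ?_)
    gcongr
    exact steadyState_zero_le hμ hν h2 hlam hsig hst1

/-- Symmetric queues have the same mean number of jobs. -/
theorem meanJobs_perm {μ : Finset ι → ℝ} (hμ : IsRank μ) {lam sig : ι → ℝ}
    (hlam : ∀ i, 0 ≤ lam i) (hsig : ∀ i, 0 < sig i)
    (hst : Stable μ fun i => lam i * sig i) (σ : Equiv.Perm ι)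
    (hσ : ∀ A : Finset ι, μ (A.map σ.toEmbedding) = μ A)
    (hρ : ∀ i, lam (σ i) * sig (σ i) = lam i * sig i) (i : ι) :
    meanJobs (steadyState lam sig μ) (σ i) = meanJobs (steadyState lam sig μ) i := by
  have hpos := hst.pos fun i => mul_nonneg (hlam i) (hsig i).le
  obtain ⟨Φ, hΦ⟩ := exists_isBalanceFunction hpos
  have hinv : ∀ x, weight Φ (fun i => lam i * sig i) (x ∘ σ) =
      weight Φ (fun i => lam i * sig i) x := by
    intro x
    have h1 : Φ (x ∘ σ) = Φ x := congrFun ((hΦ.comp_perm σ hσ).unique hΦ hpos) x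
    rw [weight, weight, h1, ← Equiv.prod_comp σ fun i => (lam i * sig i) ^ x i]
    simp [hρ]
  rw [meanJobs_eq (hΦ.steadyState_apply hμ.mono hμ.empty hlam hsig hst),
    meanJobs_eq (hΦ.steadyState_apply hμ.mono hμ.empty hlam hsig hst)]
  congr 1
  rw [← Equiv.tsum_eq (Equiv.arrowCongr σ.symm (Equiv.refl ℕ))
    fun x => (x i : ℝ≥0∞) * weight Φ (fun i => lam i * sig i) x]
  refine tsum_congr fun x => ?_
  have : Equiv.arrowCongr σ.symm (Equiv.refl ℕ) x = x ∘ σ := rfl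
  rw [this, hinv, Function.comp_apply]

theorem partMeanJobs_eq_sum {K n : ℕ} (p : PMF (Fin K × Fin n → ℕ)) (k : Fin K) :
    partMeanJobs p k = ∑ j, meanJobs p (k, j) := by
  simp only [partMeanJobs, meanJobs]
  rw [← Summable.tsum_finsetSum fun _ _ => ENNReal.summable]
  refine tsum_congr fun x => ?_
  rw [Nat.cast_sum, Finset.sum_mul]

end Comparison

section RandomSets

variable {m : ℕ}

/-! ### Negative dependence of the coverage of servers -/

/-- The probability of the outcome `T` for a uniformly random set of `d` among `m` servers. -/
noncomputable def setWeight (m d : ℕ) (T : Finset (Fin m)) : ℝ :=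
  if T.card = d then ((m.choose d : ℕ) : ℝ)⁻¹ else 0

theorem setWeight_nonneg (d : ℕ) (T : Finset (Fin m)) : 0 ≤ setWeight m d T := by
  unfold setWeight
  split_ifs <;> positivity

theorem sum_setWeight {d : ℕ} (hd : d ≤ m) : ∑ T, setWeight m d T = 1 := by
  have h : (Finset.univ.filter fun T : Finset (Fin m) => T.card = d) =
      Finset.powersetCard d Finset.univ := by
    ext T; simp [Finset.mem_powersetCard]
  simp only [setWeight]
  rw [← Finset.sum_filter, h, Finset.sum_const, Finset.card_powersetCard, Finset.card_univ,
    Fintype.card_fin, nsmul_eq_mul, mul_inv_cancel₀]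
  exact_mod_cast (Nat.choose_pos hd).ne'

/-- Exchanging the servers `s` and `u` maps the sets which contain `s` but not `u` to the sets which
contain `u` but not `s`. -/
theorem sum_swap_le {w f : Finset (Fin m) → ℝ} {s u : Fin m} (hw0 : ∀ T, 0 ≤ w T)
    (hw : ∀ T T', T.card = T'.card → w T = w T') (hf : Monotone f)
    (hs : ∀ T, f (insert s T) = f T) :
    ∑ T, (if s ∈ T ∧ u ∉ T then w T * f T else 0) ≤
      ∑ T, (if s ∉ T ∧ u ∈ T then w T * f T else 0) := by
  rw [← Equiv.sum_comp (Equiv.swap s u).finsetCongr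
    fun T => if s ∉ T ∧ u ∈ T then w T * f T else 0]
  refine Finset.sum_le_sum fun T _ => ?_
  have h1 : s ∈ (Equiv.swap s u).finsetCongr T ↔ u ∈ T := by
    simp [Equiv.finsetCongr_apply, Finset.mem_map_equiv]
  have h2 : u ∈ (Equiv.swap s u).finsetCongr T ↔ s ∈ T := by
    simp [Equiv.finsetCongr_apply, Finset.mem_map_equiv]
  simp only [h1, h2]
  by_cases h : s ∈ T ∧ u ∉ T
  · rw [if_pos h, if_pos h.symm, hw ((Equiv.swap s u).finsetCongr T) T (by simp)]
    refine mul_le_mul_of_nonneg_left ?_ (hw0 T)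
    rw [← hs ((Equiv.swap s u).finsetCongr T)]
    refine hf fun t ht => ?_
    rw [Finset.mem_insert]
    by_cases hts : t = s
    · exact Or.inl hts
    · have htu : t ≠ u := fun e => h.2 (e ▸ ht)
      right
      simpa [Equiv.finsetCongr_apply, Finset.mem_map_equiv,
        Equiv.swap_apply_of_ne_of_ne hts htu] using ht
  · rw [if_neg h, if_neg fun h' => h h'.symm]

/-- For one random set: an increasing function which does not depend on the server `s` is larger
on average when `s` is not chosen. -/
theorem mul_sum_le_sum_notMem {d : ℕ} (hd : d ≤ m) (s : Fin m) {f : Finset (Fin m) → ℝ}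
    (hf : Monotone f) (hs : ∀ T, f (insert s T) = f T) :
    (1 - (d : ℝ) / m) * ∑ T, setWeight m d T * f T ≤
      ∑ T, setWeight m d T * (f T * if s ∈ T then 0 else 1) := by
  set a := ∑ T, (if s ∉ T then setWeight m d T * f T else 0) with ha
  set b := ∑ T, (if s ∈ T then setWeight m d T * f T else 0) with hb
  have hab : ∑ T, setWeight m d T * f T = a + b := by
    rw [ha, hb, ← Finset.sum_add_distrib]
    refine Finset.sum_congr rfl fun T _ => ?_
    by_cases h : s ∈ T <;> simp [h]
  have ha' : ∑ T, setWeight m d T * (f T * if s ∈ T then 0 else 1) = a := by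
    refine Finset.sum_congr rfl fun T _ => ?_
    by_cases h : s ∈ T <;> simp [h]
  -- count the pairs of a set `T` and a server outside `T`, respectively in `T`
  have h1 : (m - d : ℝ) * b = ∑ u, ∑ T, (if s ∈ T ∧ u ∉ T then setWeight m d T * f T else 0) := by
    rw [Finset.sum_comm, hb, Finset.mul_sum]
    refine Finset.sum_congr rfl fun T _ => ?_
    by_cases h : s ∈ T
    · simp only [h, if_true, true_and]
      rw [← Finset.sum_filter, Finset.sum_const, nsmul_eq_mul]
      by_cases hc : T.card = d
      · have : (Finset.univ.filter fun u => u ∉ T).card = m - d := by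
          rw [← hc, Finset.filter_not, Finset.filter_mem_eq_inter, Finset.univ_inter,
            Finset.card_sdiff_of_subset (Finset.subset_univ T), Finset.card_univ, Fintype.card_fin]
        rw [this, Nat.cast_sub hd]
      · simp [setWeight, hc]
    · simp [h]
  have h2 : (d : ℝ) * a = ∑ u, ∑ T, (if s ∉ T ∧ u ∈ T then setWeight m d T * f T else 0) := by
    rw [Finset.sum_comm, ha, Finset.mul_sum]
    refine Finset.sum_congr rfl fun T _ => ?_
    by_cases h : s ∈ T
    · simp [h]
    · simp only [h, not_false_iff, if_true, true_and]
      rw [← Finset.sum_filter, Finset.sum_const, nsmul_eq_mul, Finset.filter_mem_eq_inter,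
        Finset.univ_inter]
      by_cases hc : T.card = d
      · rw [hc]
      · simp [setWeight, hc]
  have h3 : (m - d : ℝ) * b ≤ d * a := by
    rw [h1, h2]
    exact Finset.sum_le_sum fun u _ => sum_swap_le (setWeight_nonneg d)
      (fun T T' h => by simp [setWeight, h]) hf hs
  have hm : (0 : ℝ) < m := by exact_mod_cast Fin.pos s
  rw [hab, ha', one_sub_div hm.ne', div_mul_eq_mul_div, div_le_iff₀ hm]
  linarith

variable {ι : Type*} [Fintype ι] [DecidableEq ι]

/-- The expectation of `f (S)` for independent uniformly random sets `S i` of `d i` servers. -/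
noncomputable def assignmentMean (d : ι → ℕ) (f : (ι → Finset (Fin m)) → ℝ) : ℝ :=
  ∑ x, (∏ i, setWeight m (d i) (x i)) * f x

theorem assignmentMean_add (d : ι → ℕ) (f g : (ι → Finset (Fin m)) → ℝ) :
    assignmentMean d (fun x => f x + g x) = assignmentMean d f + assignmentMean d g := by
  simp [assignmentMean, mul_add, Finset.sum_add_distrib]

theorem assignmentMean_sub (d : ι → ℕ) (f g : (ι → Finset (Fin m)) → ℝ) :
    assignmentMean d (fun x => f x - g x) = assignmentMean d f - assignmentMean d g := by
  simp [assignmentMean, mul_sub, Finset.sum_sub_distrib]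

theorem assignmentMean_const_mul (d : ι → ℕ) (c : ℝ) (f : (ι → Finset (Fin m)) → ℝ) :
    assignmentMean d (fun x => c * f x) = c * assignmentMean d f := by
  simp [assignmentMean, mul_left_comm, Finset.mul_sum]

theorem assignmentMean_one {d : ι → ℕ} (hd : ∀ i, d i ≤ m) :
    assignmentMean d (fun _ : ι → Finset (Fin m) => 1) = 1 := by
  simp only [assignmentMean, mul_one]
  rw [← Fintype.piFinset_univ, ← Finset.prod_univ_sum]
  exact Finset.prod_eq_one fun i _ => sum_setWeight (hd i)

theorem assignmentMean_nonneg (d : ι → ℕ) {f : (ι → Finset (Fin m)) → ℝ} (hf : ∀ x, 0 ≤ f x) :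
    0 ≤ assignmentMean d f :=
  Finset.sum_nonneg fun x _ =>
    mul_nonneg (Finset.prod_nonneg fun _ _ => setWeight_nonneg _ _) (hf x)

/-- A mean is nonnegative if it is nonnegative after averaging over the set of one class only. -/
theorem assignmentMean_nonneg_of_slice (d : ι → ℕ) (i : ι) {f : (ι → Finset (Fin m)) → ℝ}
    (hf : ∀ x, 0 ≤ ∑ T, setWeight m (d i) T * f (Function.update x i T)) :
    0 ≤ assignmentMean d f := by
  set e := Equiv.funSplitAt i (Finset (Fin m)) with he
  have hupd : ∀ T y, e.symm (T, y) = Function.update (e.symm (∅, y)) i T := by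
    intro T y
    ext1 j
    by_cases h : j = i
    · subst h; simp [he]
    · simp [he, h]
  have hW : ∀ T y, ∏ j, setWeight m (d j) (e.symm (T, y) j) =
      setWeight m (d i) T * ∏ j : {j // j ≠ i}, setWeight m (d j) (y j) := by
    intro T y
    rw [Fintype.prod_eq_mul_prod_subtype_ne _ i]
    congr 1
    · simp [he]
    · refine Finset.prod_congr rfl fun j _ => ?_
      simp [he, j.2]
  rw [assignmentMean, ← Equiv.sum_comp e.symm, Fintype.sum_prod_type_right]
  refine Finset.sum_nonneg fun y _ => ?_
  simp only [hW]
  have h1 : ∑ T, setWeight m (d i) T * (∏ j : {j // j ≠ i}, setWeight m (d j) (y j)) *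
      f (e.symm (T, y)) = (∏ j : {j // j ≠ i}, setWeight m (d j) (y j)) *
      ∑ T, setWeight m (d i) T * f (Function.update (e.symm (∅, y)) i T) := by
    rw [Finset.mul_sum]
    refine Finset.sum_congr rfl fun T _ => ?_
    rw [hupd T y]
    ring
  rw [h1]
  exact mul_nonneg (Finset.prod_nonneg fun j _ => setWeight_nonneg _ _) (hf _)

/-- An increasing function of the assignment which does not depend on the server `s` is larger on
average when no class of `A` can be served by `s`. -/
theorem prod_mul_assignmentMean_le {d : ι → ℕ} (hd : ∀ i, d i ≤ m) (s : Fin m)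
    {f : (ι → Finset (Fin m)) → ℝ} (hf : Monotone f)
    (hs : ∀ x i T, f (Function.update x i (insert s T)) = f (Function.update x i T))
    (A : Finset ι) :
    (∏ i ∈ A, (1 - (d i : ℝ) / m)) * assignmentMean d f ≤
      assignmentMean d fun x => f x * ∏ i ∈ A, if s ∈ x i then 0 else 1 := by
  have hm : (0 : ℝ) < m := by exact_mod_cast Fin.pos s
  have hq : ∀ i, 0 ≤ 1 - (d i : ℝ) / m := fun i =>
    sub_nonneg.2 ((div_le_one hm).2 (by exact_mod_cast hd i))
  induction A using Finset.induction_on with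
  | empty => simp
  | insert i A hi ih =>
    simp only [Finset.prod_insert hi]
    rw [mul_assoc]
    refine (mul_le_mul_of_nonneg_left ih (hq i)).trans ?_
    rw [← sub_nonneg, ← assignmentMean_const_mul, ← assignmentMean_sub]
    refine assignmentMean_nonneg_of_slice d i fun x => ?_
    -- the factors of the classes in `A` do not depend on the set of class `i`
    have hC : ∀ T, (∏ j ∈ A, if s ∈ Function.update x i T j then (0 : ℝ) else 1) =
        ∏ j ∈ A, if s ∈ x j then 0 else 1 := by
      intro T
      refine Finset.prod_congr rfl fun j hj => ?_
      rw [Function.update_of_ne (ne_of_mem_of_not_mem hj hi)]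
    have hC0 : (0 : ℝ) ≤ ∏ j ∈ A, if s ∈ x j then (0 : ℝ) else 1 :=
      Finset.prod_nonneg fun j _ => by split_ifs <;> norm_num
    simp only [hC, Function.update_self]
    set C : ℝ := ∏ j ∈ A, if s ∈ x j then (0 : ℝ) else 1
    have hupd : Monotone fun T => Function.update x i T := by
      intro T T' h j
      by_cases hj : j = i
      · subst hj; simpa using h
      · simp [hj]
    have h1 := mul_sum_le_sum_notMem (hd i) s (f := fun T => f (Function.update x i T) * C)
      (fun T T' h => mul_le_mul_of_nonneg_right
        (hf (hupd h)) hC0)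
      fun T => by simp only [hs]
    rw [← sub_nonneg] at h1
    refine h1.trans_eq ?_
    rw [Finset.mul_sum, ← Finset.sum_sub_distrib]
    exact Finset.sum_congr rfl fun T _ => by ring

/-- The probability that a given server can serve some class of `A`. -/
noncomputable def coverProb (m : ℕ) (d : ι → ℕ) (A : Finset ι) : ℝ :=
  1 - ∏ i ∈ A, (1 - (d i : ℝ) / m)

theorem prod_ite_mem_eq {ι : Type*} (s : Fin m) (A : Finset ι)
    (x : ι → Finset (Fin m)) :
    (∏ i ∈ A, if s ∈ x i then (0 : ℝ) else 1) = if s ∈ A.biUnion x then 0 else 1 := by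
  split_ifs with h
  · obtain ⟨i, hi, hs⟩ := Finset.mem_biUnion.1 h
    exact Finset.prod_eq_zero hi (if_pos hs)
  · exact Finset.prod_eq_one fun i hi => if_neg fun hs => h (Finset.mem_biUnion.2 ⟨i, hi, hs⟩)

theorem assignmentMean_ite_mem {d : ι → ℕ} (hd : ∀ i, d i ≤ m) (s : Fin m) (A : Finset ι) :
    assignmentMean d (fun x => if s ∈ A.biUnion x then 1 else 0) = coverProb m d A := by
  have h1 := prod_mul_assignmentMean_le hd s (f := fun _ => 1) monotone_const
    (fun _ _ _ => rfl) A
  have h2 := prod_mul_assignmentMean_le hd s (f := fun _ => -1 * 1) monotone_const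
    (fun _ _ _ => rfl) A
  simp only [prod_ite_mem_eq, mul_assoc, assignmentMean_const_mul, assignmentMean_one hd] at h1 h2
  have h3 : assignmentMean d (fun x => (if s ∈ A.biUnion x then 1 else 0) +
      1 * if s ∈ A.biUnion x then 0 else 1) = 1 := by
    refine (congrArg _ (funext fun x => ?_)).trans (assignmentMean_one hd)
    split_ifs <;> norm_num
  rw [assignmentMean_add, assignmentMean_const_mul] at h3
  unfold coverProb
  linarith

/-- The number of covered servers of `G` has exponential moments bounded by those of a Poisson
variable with the same mean. -/
theorem assignmentMean_exp_le {d : ι → ℕ} (hd : ∀ i, d i ≤ m) (A : Finset ι) (θ : ℝ)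
    (G : Finset (Fin m)) :
    assignmentMean d (fun x => Real.exp (θ * (A.biUnion x ∩ G).card)) ≤
      Real.exp ((Real.exp θ - 1) * (coverProb m d A * G.card)) := by
  induction G using Finset.induction_on with
  | empty => simp [assignmentMean_one hd]
  | insert s G hsG ih =>
    set c := Real.exp θ - 1 with hc
    set h : (ι → Finset (Fin m)) → ℝ := fun x => Real.exp (θ * (A.biUnion x ∩ G).card) with hh
    -- `c * h` is increasing, whatever the sign of `θ`
    have hmono : Monotone fun x => c * h x := by
      intro x y hxy
      have hcard : ((A.biUnion x ∩ G).card : ℝ) ≤ (A.biUnion y ∩ G).card := by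
        exact_mod_cast Finset.card_le_card
          (Finset.inter_subset_inter_right (Finset.biUnion_mono fun i _ => hxy i))
      rcases le_total 0 θ with hθ | hθ
      · refine mul_le_mul_of_nonneg_left (Real.exp_le_exp.2
          (mul_le_mul_of_nonneg_left hcard hθ)) ?_
        linarith [Real.one_le_exp hθ]
      · refine mul_le_mul_of_nonpos_left (Real.exp_le_exp.2
          (mul_le_mul_of_nonpos_left hcard hθ)) ?_
        linarith [Real.exp_le_one_iff.2 hθ]
    have hign : ∀ x i T, c * h (Function.update x i (insert s T)) =
        c * h (Function.update x i T) := by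
      intro x i T
      have : A.biUnion (Function.update x i (insert s T)) ∩ G =
          A.biUnion (Function.update x i T) ∩ G := by
        ext t
        simp only [Finset.mem_inter, Finset.mem_biUnion, and_congr_left_iff]
        intro ht
        have hts : t ≠ s := ne_of_mem_of_not_mem ht hsG
        refine exists_congr fun j => and_congr_right fun _ => ?_
        by_cases hj : j = i
        · subst hj; simp [hts]
        · simp [hj]
      simp only [hh, this]
    have hneg := prod_mul_assignmentMean_le hd s hmono hign A
    simp only [prod_ite_mem_eq] at hneg
    have hexp : (fun x => Real.exp (θ * (A.biUnion x ∩ insert s G).card)) = fun x =>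
        (1 + c) * h x + -1 * (c * h x * if s ∈ A.biUnion x then 0 else 1) := by
      ext x
      by_cases hs : s ∈ A.biUnion x
      · rw [Finset.inter_insert_of_mem hs, Finset.card_insert_of_notMem (by simp [hsG])]
        simp only [hs, if_true, hc, hh]
        push_cast
        rw [mul_add, Real.exp_add]
        ring_nf
      · rw [Finset.inter_insert_of_notMem hs]
        simp only [hs, if_false]
        ring_nf
        rfl
    rw [hexp, assignmentMean_add, assignmentMean_const_mul, assignmentMean_const_mul]
    rw [assignmentMean_const_mul] at hneg
    have h0 : 0 ≤ assignmentMean d h := assignmentMean_nonneg d fun x => (Real.exp_pos _).le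
    have hle : 1 + c * coverProb m d A ≤ Real.exp (c * coverProb m d A) := by
      linarith [Real.add_one_le_exp (c * coverProb m d A)]
    calc (1 + c) * assignmentMean d h + -1 * assignmentMean d (fun x => c * h x *
            if s ∈ A.biUnion x then 0 else 1)
        ≤ (1 + c * coverProb m d A) * assignmentMean d h := by
          unfold coverProb; linarith
      _ ≤ Real.exp (c * coverProb m d A) * Real.exp (c * (coverProb m d A * G.card)) :=
          mul_le_mul hle ih h0 (Real.exp_pos _).le
      _ = _ := by
          rw [← Real.exp_add, Finset.card_insert_of_notMem hsG]
          push_cast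
          ring_nf

end RandomSets

/-! ### Concentration of the rank function -/

section CoverProb

variable {m : ℕ} {ι : Type*}

theorem coverProb_le_one {d : ι → ℕ} (hd : ∀ i, d i ≤ m) (A : Finset ι) : coverProb m d A ≤ 1 := by
  refine sub_le_self _ (Finset.prod_nonneg fun i _ => sub_nonneg.2 ?_)
  exact div_le_one_of_le₀ (by exact_mod_cast hd i) (Nat.cast_nonneg m)

theorem coverProb_nonneg {d : ι → ℕ} (hd : ∀ i, d i ≤ m) (A : Finset ι) : 0 ≤ coverProb m d A := by
  refine sub_nonneg.2 (Finset.prod_le_one (fun i _ => sub_nonneg.2 ?_) fun i _ => ?_)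
  · exact div_le_one_of_le₀ (by exact_mod_cast hd i) (Nat.cast_nonneg m)
  · exact sub_le_self _ (by positivity)

theorem one_sub_exp_le_coverProb {d : ι → ℕ} (hd : ∀ i, d i ≤ m) {r : ℝ} (hr : ∀ i, r ≤ d i)
    (A : Finset ι) : 1 - Real.exp (-(A.card * r / m)) ≤ coverProb m d A := by
  refine sub_le_sub_left ?_ 1
  calc ∏ i ∈ A, (1 - (d i : ℝ) / m) ≤ ∏ _i ∈ A, Real.exp (-(r / m)) := by
        refine Finset.prod_le_prod (fun i _ => sub_nonneg.2
          (div_le_one_of_le₀ (by exact_mod_cast hd i) (Nat.cast_nonneg m))) fun i _ => ?_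
        have h1 : r / m ≤ d i / m := div_le_div_of_nonneg_right (hr i) (Nat.cast_nonneg m)
        linarith [Real.add_one_le_exp (-(r / m))]
    _ = Real.exp (-(A.card * r / m)) := by
        rw [Finset.prod_const, ← Real.exp_nat_mul]
        congr 1
        ring

/-- The number `X` of servers of `G` which can serve some class of `A` is close to its mean
`c |G|`, where `c` is the probability for each server. -/
def IsNear (δ : ℝ) (d : ι → ℕ) (G : Finset (Fin m)) (x : ι → Finset (Fin m)) (A : Finset ι) :
    Prop :=
  (1 - δ) * (coverProb m d A * G.card) ≤ (A.biUnion x ∩ G).card ∧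
    ((A.biUnion x ∩ G).card : ℝ) ≤ (1 + δ) * (coverProb m d A * G.card)

/-- Once the small sets of classes are near their means, all of them are: the largest among the
small sets already cover nearly all servers. -/
theorem isNear_of_small {d : ι → ℕ} {x : ι → Finset (Fin m)} (hd : ∀ i, d i ≤ m) {r T δ ε : ℝ}
    (hr0 : 0 < r) (hr : ∀ i, r ≤ d i) (hδ0 : 0 ≤ δ) (hδε : δ ≤ ε) (hε : ε < 1) (hT : 1 ≤ T)
    (hT1 : 1 - ε ≤ (1 - δ) * (1 - Real.exp (-(T - 1))))
    (hT2 : 1 ≤ (1 + ε) * (1 - Real.exp (-T))) {G : Finset (Fin m)}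
    (hsmall : ∀ A : Finset ι, A.Nonempty → A.card * r ≤ T * m → IsNear δ d G x A)
    (A : Finset ι) : IsNear ε d G x A := by
  have hG : (0 : ℝ) ≤ G.card := Nat.cast_nonneg _
  rcases A.eq_empty_or_nonempty with rfl | ⟨i, hi⟩
  · simp [IsNear, coverProb]
  have hrm : r ≤ m := (hr i).trans (by exact_mod_cast hd i)
  have hm : (0 : ℝ) < m := hr0.trans_le hrm
  rcases le_or_gt (A.card * r) (T * m) with h | h
  · obtain ⟨h1, h2⟩ := hsmall A ⟨i, hi⟩ h
    have hM := mul_nonneg (coverProb_nonneg hd A) hG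
    exact ⟨by nlinarith, by nlinarith⟩
  · constructor
    · -- compare with a subset of the largest size covered by the hypothesis
      set a := ⌊T * m / r⌋₊ with ha
      have ha1 : (a : ℝ) * r ≤ T * m := by
        rw [← le_div_iff₀ hr0]
        exact Nat.floor_le (by positivity)
      have ha2 : (T - 1) * m ≤ a * r := by
        have := Nat.lt_floor_add_one (T * m / r)
        rw [div_lt_iff₀ hr0] at this
        nlinarith
      have ha3 : a ≤ A.card := by
        have h3 : (a : ℝ) * r ≤ A.card * r := ha1.trans h.le
        exact_mod_cast le_of_mul_le_mul_right h3 hr0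
      have ha4 : 1 ≤ a := by
        rw [ha, Nat.one_le_floor_iff, one_le_div hr0]
        nlinarith
      obtain ⟨B, hBA, hBa⟩ := Finset.exists_subset_card_eq ha3
      have hB := (hsmall B (Finset.card_pos.1 (by omega)) (by rwa [hBa])).1
      have hX : ((B.biUnion x ∩ G).card : ℝ) ≤ (A.biUnion x ∩ G).card := by
        exact_mod_cast Finset.card_le_card
          (Finset.inter_subset_inter_right (Finset.biUnion_subset_biUnion_of_subset_left _ hBA))
      have hcB : 1 - Real.exp (-(T - 1)) ≤ coverProb m d B := by
        refine le_trans ?_ (one_sub_exp_le_coverProb hd hr B)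
        rw [hBa]
        have : T - 1 ≤ a * r / m := (le_div_iff₀ hm).2 ha2
        gcongr
      calc (1 - ε) * (coverProb m d A * G.card) ≤ (1 - ε) * (1 * G.card) := by
            have := coverProb_le_one hd A
            gcongr
        _ ≤ (1 - δ) * (1 - Real.exp (-(T - 1))) * (1 * G.card) := by gcongr
        _ ≤ (1 - δ) * coverProb m d B * (1 * G.card) := by
            have : 0 ≤ 1 - δ := by linarith
            gcongr
        _ ≤ (B.biUnion x ∩ G).card := by linarith
        _ ≤ _ := hX
    · have hcA : 1 - Real.exp (-T) ≤ coverProb m d A := by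
        refine le_trans ?_ (one_sub_exp_le_coverProb hd hr A)
        have : T ≤ A.card * r / m := (le_div_iff₀ hm).2 h.le
        gcongr
      calc ((A.biUnion x ∩ G).card : ℝ) ≤ 1 * G.card := by
            rw [one_mul]
            exact_mod_cast Finset.card_le_card Finset.inter_subset_right
        _ ≤ (1 + ε) * (1 - Real.exp (-T)) * G.card := by gcongr
        _ ≤ (1 + ε) * coverProb m d A * G.card := by
            have : 0 ≤ 1 + ε := by linarith
            gcongr
        _ = _ := by ring

/-- If in each group of equal servers the number of covered servers is near its mean, then so is
the rank function. -/
theorem clusterRank_near {J : ℕ} {cap : Fin m → ℝ} (hcap : ∀ s, 0 ≤ cap s) {grp : Fin m → Fin J}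
    (hgrp : ∀ s t, grp s = grp t → cap s = cap t) {ε : ℝ} {d : ι → ℕ} {x : ι → Finset (Fin m)}
    {A : Finset ι} (h : ∀ j, IsNear ε d (Finset.univ.filter fun s => grp s = j) x A) :
    (1 - ε) * (coverProb m d A * ∑ s, cap s) ≤ clusterRank cap x A ∧
      clusterRank cap x A ≤ (1 + ε) * (coverProb m d A * ∑ s, cap s) := by
  obtain ⟨c, hc0, hc⟩ : ∃ c : Fin J → ℝ, (∀ j, 0 ≤ c j) ∧ ∀ s, cap s = c (grp s) := by
    classical
    refine ⟨fun j => if h : ∃ s, grp s = j then cap h.choose else 0, fun j => ?_, fun s => ?_⟩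
    · dsimp only
      split_ifs
      exacts [hcap _, le_rfl]
    · have hs : ∃ t, grp t = grp s := ⟨s, rfl⟩
      simp only [hs, dif_pos]
      exact hgrp _ _ hs.choose_spec.symm
  have hsum : ∀ U : Finset (Fin m), ∑ s ∈ U, cap s =
      ∑ j, c j * ((U ∩ Finset.univ.filter fun s => grp s = j).card : ℝ) := by
    intro U
    rw [← Finset.sum_fiberwise U grp]
    refine Finset.sum_congr rfl fun j _ => ?_
    rw [Finset.sum_congr rfl fun s hs => (hc s).trans (by rw [(Finset.mem_filter.1 hs).2]),
      Finset.sum_const, nsmul_eq_mul, mul_comm]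
    congr 3
    ext s; simp
  have hall := hsum Finset.univ
  simp only [Finset.univ_inter] at hall
  rw [clusterRank, hall, hsum]
  simp only [Finset.mul_sum]
  constructor <;> refine Finset.sum_le_sum fun j _ => ?_
  · calc _ = c j * ((1 - ε) * (coverProb m d A *
          (Finset.univ.filter fun s => grp s = j).card)) := by ring
      _ ≤ _ := mul_le_mul_of_nonneg_left (h j).1 (hc0 j)
  · calc _ ≤ c j * ((1 + ε) * (coverProb m d A *
          (Finset.univ.filter fun s => grp s = j).card)) :=
        mul_le_mul_of_nonneg_left (h j).2 (hc0 j)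
      _ = _ := by ring

end CoverProb

section Law

variable {m : ℕ} {ι : Type*} [Fintype ι] {Ω : Type*} [MeasurableSpace Ω] {P : Measure Ω}
  {d : ι → ℕ} {S : ι → Ω → Finset (Fin m)}

theorem IsRandomAssignment.measureReal_preimage (hS : IsRandomAssignment P d S)
    (x : ι → Finset (Fin m)) :
    P.real ((fun ω i => S i ω) ⁻¹' {x}) = ∏ i, setWeight m (d i) (x i) := by
  have h1 : (fun ω i => S i ω) ⁻¹' {x} = ⋂ i ∈ Finset.univ, S i ⁻¹' {x i} := by
    ext ω; simp [funext_iff]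
  rw [h1, Measure.real, hS.indep.measure_inter_preimage_eq_mul Finset.univ
    (sets := fun i => {x i}) (fun i _ => trivial), ENNReal.toReal_prod]
  refine Finset.prod_congr rfl fun i _ => ?_
  rw [hS.uniform, setWeight]
  split_ifs <;> simp

theorem IsRandomAssignment.measurableSet_preimage (hS : IsRandomAssignment P d S)
    (x : ι → Finset (Fin m)) : MeasurableSet ((fun ω i => S i ω) ⁻¹' {x}) := by
  have h1 : (fun ω i => S i ω) ⁻¹' {x} = ⋂ i, S i ⁻¹' {x i} := by
    ext ω; simp [funext_iff]
  rw [h1]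
  exact MeasurableSet.iInter fun i => hS.measurable i _

end Law

section Concentration

variable {m : ℕ} {ι : Type*} [Fintype ι] [DecidableEq ι] {Ω : Type*} [MeasurableSpace Ω]
  {P : Measure Ω} [IsProbabilityMeasure P] {d : ι → ℕ} {S : ι → Ω → Finset (Fin m)}

/-- Expectations of functions of the random assignment are finite sums. -/
theorem IsRandomAssignment.integral_eq (hS : IsRandomAssignment P d S)
    (f : (ι → Finset (Fin m)) → ℝ) :
    Integrable (fun ω => f fun i => S i ω) P ∧
      ∫ ω, f (fun i => S i ω) ∂P = assignmentMean d f := by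
  let _ : MeasurableSpace (ι → Finset (Fin m)) := ⊤
  have _ : MeasurableSingletonClass (ι → Finset (Fin m)) := ⟨fun _ => trivial⟩
  have hmeas : Measurable fun ω i => S i ω :=
    measurable_to_countable' fun x => hS.measurableSet_preimage x
  have _ : IsProbabilityMeasure (P.map fun ω i => S i ω) :=
    Measure.isProbabilityMeasure_map hmeas.aemeasurable
  have hint : Integrable f (P.map fun ω i => S i ω) := Integrable.of_finite
  refine ⟨(integrable_map_measure hint.aestronglyMeasurable hmeas.aemeasurable).1 hint, ?_⟩
  rw [← integral_map hmeas.aemeasurable hint.aestronglyMeasurable, integral_fintype hint]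
  refine Finset.sum_congr rfl fun x _ => ?_
  rw [map_measureReal_apply hmeas trivial, hS.measureReal_preimage, smul_eq_mul]

/-- The exponential rate in the bound for relative deviations of size `δ` of a Poisson variable. -/
noncomputable def chernoffRate (δ : ℝ) : ℝ :=
  min ((1 + δ) * Real.log (1 + δ) - δ) ((1 - δ) * Real.log (1 - δ) + δ)

theorem sub_one_lt_mul_log {y : ℝ} (hy : 0 < y) (hy1 : y ≠ 1) : y - 1 < y * Real.log y := by
  have h := Real.log_lt_sub_one_of_pos (inv_pos.2 hy) (by simpa using hy1)
  rw [Real.log_inv] at h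
  have h2 := mul_lt_mul_of_pos_left h hy
  rw [mul_sub, mul_inv_cancel₀ hy.ne'] at h2
  linarith

theorem chernoffRate_pos {δ : ℝ} (h0 : 0 < δ) (h1 : δ < 1) : 0 < chernoffRate δ := by
  refine lt_min ?_ ?_
  · linarith [sub_one_lt_mul_log (y := 1 + δ) (by linarith) (by linarith)]
  · linarith [sub_one_lt_mul_log (y := 1 - δ) (by linarith) (by linarith)]

theorem measureReal_not_isNear_le (hS : IsRandomAssignment P d S) (hd : ∀ i, d i ≤ m) {δ : ℝ}
    (h0 : 0 < δ) (h1 : δ < 1) (G : Finset (Fin m)) (A : Finset ι) :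
    P.real {ω | ¬ IsNear δ d G (fun i => S i ω) A} ≤
      2 * Real.exp (-(chernoffRate δ * (coverProb m d A * G.card))) := by
  set M : ℝ := coverProb m d A * G.card with hM
  have hM0 : 0 ≤ M := mul_nonneg (coverProb_nonneg hd A) (Nat.cast_nonneg _)
  set X : Ω → ℝ := fun ω => ((A.biUnion (fun i => S i ω) ∩ G).card : ℝ) with hX
  have hint : ∀ θ, Integrable (fun ω => Real.exp (θ * X ω)) P := fun θ =>
    (hS.integral_eq fun x => Real.exp (θ * (A.biUnion x ∩ G).card)).1
  have hmgf : ∀ θ, mgf X P θ ≤ Real.exp ((Real.exp θ - 1) * M) := fun θ => by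
    rw [mgf, (hS.integral_eq fun x => Real.exp (θ * (A.biUnion x ∩ G).card)).2]
    exact assignmentMean_exp_le hd A θ G
  have hup : P.real {ω | (1 + δ) * M ≤ X ω} ≤ Real.exp (-(chernoffRate δ * M)) := by
    refine (measure_ge_le_exp_mul_mgf ((1 + δ) * M) (Real.log_nonneg (by linarith : 1 ≤ 1 + δ))
      (hint _)).trans ((mul_le_mul_of_nonneg_left (hmgf _) (Real.exp_pos _).le).trans ?_)
    rw [← Real.exp_add, Real.exp_le_exp, Real.exp_log (by linarith)]
    have := mul_le_mul_of_nonneg_right (min_le_left ((1 + δ) * Real.log (1 + δ) - δ)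
      ((1 - δ) * Real.log (1 - δ) + δ)) hM0
    unfold chernoffRate
    linarith
  have hlow : P.real {ω | X ω ≤ (1 - δ) * M} ≤ Real.exp (-(chernoffRate δ * M)) := by
    refine (measure_le_le_exp_mul_mgf ((1 - δ) * M)
      (Real.log_nonpos (by linarith) (by linarith : 1 - δ ≤ 1))
      (hint _)).trans ((mul_le_mul_of_nonneg_left (hmgf _) (Real.exp_pos _).le).trans ?_)
    rw [← Real.exp_add, Real.exp_le_exp, Real.exp_log (by linarith)]
    have := mul_le_mul_of_nonneg_right (min_le_right ((1 + δ) * Real.log (1 + δ) - δ)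
      ((1 - δ) * Real.log (1 - δ) + δ)) hM0
    unfold chernoffRate
    linarith
  have hsub : {ω | ¬ IsNear δ d G (fun i => S i ω) A} ⊆
      {ω | (1 + δ) * M ≤ X ω} ∪ {ω | X ω ≤ (1 - δ) * M} := by
    intro ω hω
    by_contra h
    simp only [Set.mem_union, Set.mem_ofPred_eq, not_or, not_le] at h
    exact hω ⟨h.2.le, h.1.le⟩
  calc P.real {ω | ¬ IsNear δ d G (fun i => S i ω) A}
      ≤ P.real ({ω | (1 + δ) * M ≤ X ω} ∪ {ω | X ω ≤ (1 - δ) * M}) := measureReal_mono hsub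
    _ ≤ _ := measureReal_union_le _ _
    _ ≤ _ := by linarith

/-- Union bound over the sets of classes for which the exponential bound beats their number. -/
theorem measureReal_exists_not_isNear_le (hS : IsRandomAssignment P d S) (hd : ∀ i, d i ≤ m)
    {δ : ℝ} (h0 : 0 < δ) (h1 : δ < 1) (G : Finset (Fin m)) (p : Finset ι → Prop) {y : ℝ}
    (hp : ∀ A, p A → y * A.card ≤ chernoffRate δ * (coverProb m d A * G.card)) :
    P.real {ω | ∃ A : Finset ι, A.Nonempty ∧ p A ∧ ¬ IsNear δ d G (fun i => S i ω) A} ≤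
      2 * ((1 + Real.exp (-y)) ^ Fintype.card ι - 1) := by
  classical
  set F : Finset (Finset ι) := Finset.univ.filter fun A => A.Nonempty ∧ p A with hF
  have hsub : {ω | ∃ A : Finset ι, A.Nonempty ∧ p A ∧ ¬ IsNear δ d G (fun i => S i ω) A} ⊆
      ⋃ A ∈ F, {ω | ¬ IsNear δ d G (fun i => S i ω) A} := by
    rintro ω ⟨A, hA, hpA, h⟩
    exact Set.mem_biUnion (by simpa [hF] using ⟨hA, hpA⟩) h
  calc _ ≤ P.real (⋃ A ∈ F, {ω | ¬ IsNear δ d G (fun i => S i ω) A}) :=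
        measureReal_mono hsub (measure_ne_top _ _)
    _ ≤ ∑ A ∈ F, P.real {ω | ¬ IsNear δ d G (fun i => S i ω) A} :=
        measureReal_biUnion_finset_le _ _
    _ ≤ ∑ A ∈ F, 2 * Real.exp (-y) ^ A.card := by
        refine Finset.sum_le_sum fun A hA => (measureReal_not_isNear_le hS hd h0 h1 G A).trans ?_
        rw [← Real.exp_nat_mul]
        have := hp A (Finset.mem_filter.1 hA).2.2
        gcongr
        linarith
    _ ≤ ∑ A ∈ (Finset.univ : Finset (Finset ι)).erase ∅, 2 * Real.exp (-y) ^ A.card := by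
        refine Finset.sum_le_sum_of_subset_of_nonneg (fun A hA => ?_) fun A _ _ => by positivity
        simpa [Finset.nonempty_iff_ne_empty] using (Finset.mem_filter.1 hA).2.1.ne_empty
    _ = _ := by
        rw [← Finset.mul_sum, Finset.sum_erase_eq_sub (Finset.mem_univ _)]
        have := Finset.sum_pow_mul_eq_add_pow (Real.exp (-y)) 1 (Finset.univ : Finset ι)
        simp only [one_pow, mul_one, Finset.powerset_univ, Finset.card_univ] at this
        rw [this, Finset.card_empty, pow_zero, add_comm (Real.exp (-y))]

theorem meanRank_eq (hS : IsRandomAssignment P d S) (hd : ∀ i, d i ≤ m) (cap : Fin m → ℝ)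
    (A : Finset ι) : meanRank P cap S A = coverProb m d A * ∑ s, cap s := by
  rw [meanRank, (hS.integral_eq fun x => clusterRank cap x A).2, Finset.mul_sum]
  have h : ∀ x : ι → Finset (Fin m), clusterRank cap x A =
      ∑ s, cap s * if s ∈ A.biUnion x then 1 else 0 := by
    intro x
    simp only [clusterRank, mul_ite, mul_one, mul_zero]
    rw [← Finset.sum_filter, Finset.filter_mem_eq_inter, Finset.univ_inter]
  simp only [h]
  rw [assignmentMean]
  simp only [Finset.mul_sum]
  rw [Finset.sum_comm]
  refine Finset.sum_congr rfl fun s _ => ?_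
  rw [← assignmentMean_ite_mem hd s A, mul_comm, ← assignmentMean_const_mul, assignmentMean]

end Concentration

/-! ### Asymptotics -/

theorem clusterRank_mono {ι : Type*} {m : ℕ} {cap : Fin m → ℝ} (hcap : ∀ s, 0 ≤ cap s)
    (x : ι → Finset (Fin m)) : Monotone (clusterRank cap x) := fun _ _ h =>
  Finset.sum_le_sum_of_subset_of_nonneg (Finset.biUnion_subset_biUnion_of_subset_left x h)
    fun s _ _ => hcap s

theorem isRank_clusterRank {ι : Type*} {m : ℕ} {cap : Fin m → ℝ} (hcap : ∀ s, 0 ≤ cap s)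
    (x : ι → Finset (Fin m)) : IsRank (clusterRank cap x) :=
  ⟨clusterRank_mono hcap x, by simp [clusterRank]⟩

theorem isRank_mul_meanRank {ι Ω : Type*} [Fintype ι] [DecidableEq ι] [MeasurableSpace Ω]
    {P : Measure Ω} [IsProbabilityMeasure P] {m : ℕ} {d : ι → ℕ} {S : ι → Ω → Finset (Fin m)}
    (hS : IsRandomAssignment P d S) {cap : Fin m → ℝ} (hcap : ∀ s, 0 ≤ cap s) {c : ℝ}
    (hc : 0 ≤ c) : IsRank fun A => c * meanRank P cap S A := by
  refine ⟨fun A B h => mul_le_mul_of_nonneg_left (integral_mono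
    (hS.integral_eq fun x => clusterRank cap x A).1
    (hS.integral_eq fun x => clusterRank cap x B).1
    fun ω => clusterRank_mono hcap _ h) hc, by simp [meanRank, clusterRank]⟩

/-- Queues of the same part have the same mean number of jobs in a system whose rank function is a
multiple of the mean rank function. -/
theorem partMeanJobs_div {K n : ℕ} {Ω : Type*} [MeasurableSpace Ω] {P : Measure Ω}
    [IsProbabilityMeasure P] {m : ℕ} {d : Fin K → ℕ} (hd : ∀ k, d k ≤ m)
    {S : Fin K × Fin n → Ω → Finset (Fin m)} (hS : IsRandomAssignment P (fun i => d i.1) S)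
    {cap : Fin m → ℝ} (hcap : ∀ s, 0 ≤ cap s) {c : ℝ} (hc : 0 ≤ c)
    {lam sig : Fin K × Fin n → ℝ} {ϱ : Fin K → ℝ} (hlam : ∀ i, 0 ≤ lam i) (hsig : ∀ i, 0 < sig i)
    (hϱ : ∀ i, lam i * sig i = ϱ i.1)
    (hst : Stable (fun A => c * meanRank P cap S A) fun i => lam i * sig i)
    (k : Fin K) (j : Fin n) :
    partMeanJobs (steadyState lam sig fun A => c * meanRank P cap S A) k / n =
      meanJobs (steadyState lam sig fun A => c * meanRank P cap S A) (k, j) := by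
  have hn : (n : ℝ≥0∞) ≠ 0 := by
    have := j.pos
    exact_mod_cast this.ne'
  have hsymm : ∀ j', meanJobs (steadyState lam sig fun A => c * meanRank P cap S A) (k, j') =
      meanJobs (steadyState lam sig fun A => c * meanRank P cap S A) (k, j) := by
    intro j'
    have hfst : ∀ i, (Equiv.swap (k, j) (k, j') i).1 = i.1 := by
      intro i
      rw [Equiv.swap_apply_def]
      split_ifs with h1 h2
      · rw [h1]
      · rw [h2]
      · rfl
    have h := meanJobs_perm (isRank_mul_meanRank hS hcap hc) hlam hsig hst
      (Equiv.swap (k, j) (k, j')) (fun A => by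
        rw [meanRank_eq hS (fun i => hd i.1), meanRank_eq hS (fun i => hd i.1), coverProb, coverProb,
          Finset.prod_map]
        simp [hfst]) (fun i => by rw [hϱ, hϱ, hfst]) (k, j)
    rwa [Equiv.swap_apply_left] at h
  rw [partMeanJobs_eq_sum, Finset.sum_congr rfl fun j' _ => hsymm j', Finset.sum_const,
    Finset.card_univ, Fintype.card_fin, nsmul_eq_mul, ENNReal.div_eq_inv_mul, ← mul_assoc,
    ENNReal.inv_mul_cancel hn (ENNReal.natCast_ne_top n), one_mul]

/-- The threshold `1 + 2 / ε` for the expected number of times that a server is covered: beyond it,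
a proportion of servers close to one is covered. -/
theorem threshold_bounds {ε : ℝ} (h0 : 0 < ε) (hε1 : ε < 1) :
    1 - ε ≤ (1 - ε / 2) * (1 - Real.exp (-(1 + 2 / ε - 1))) ∧
      1 ≤ (1 + ε) * (1 - Real.exp (-(1 + 2 / ε))) := by
  have h1 : ∀ u, 2 / ε ≤ u → Real.exp (-u) ≤ ε / (ε + 2) := by
    intro u hu
    rw [Real.exp_neg, ← inv_div]
    refine inv_anti₀ (by positivity) ?_
    have h2 := Real.add_one_le_exp u
    have h3 : (ε + 2) / ε = 2 / ε + 1 := by field_simp; ring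
    linarith
  have h2 := h1 (1 + 2 / ε - 1) (by linarith)
  have h3 := h1 (1 + 2 / ε) (by linarith)
  have h4 : 1 - ε / (ε + 2) = 2 / (ε + 2) := by field_simp; ring
  constructor
  · refine le_trans ?_ (mul_le_mul_of_nonneg_left (sub_le_sub_left h2 1) (by linarith))
    rw [h4, mul_div_assoc', le_div_iff₀ (by linarith)]
    nlinarith
  · refine le_trans ?_ (mul_le_mul_of_nonneg_left (sub_le_sub_left h3 1) (by linarith))
    rw [h4, mul_div_assoc', le_div_iff₀ (by linarith)]
    nlinarith

theorem one_add_pow_sub_one_le {y : ℝ} (hy : 0 ≤ y) {N : ℕ} (h : N * y ≤ 1) :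
    (1 + y) ^ N - 1 ≤ 2 * (N * y) := by
  have h1 : (1 + y) ^ N ≤ Real.exp (N * y) := by
    rw [Real.exp_nat_mul]
    exact pow_le_pow_left₀ (by linarith) (by linarith [Real.add_one_le_exp y]) N
  have h0 : 0 ≤ N * y := by positivity
  have h2 := Real.abs_exp_sub_one_le (x := N * y) (by rwa [abs_of_nonneg h0])
  rw [abs_of_nonneg h0] at h2
  linarith [le_abs_self (Real.exp (N * y) - 1)]

/-- The realized rank function is uniformly close to its mean, except on an event of probability
`O(1 / n²)`. -/
theorem exists_eventually_measureReal_le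
    (K : ℕ) (b : ℝ) (hb : 0 < b) (ε : ℝ) (hε0 : 0 < ε) (hε1 : ε < 1)
    (cap : ∀ n : ℕ, Fin ⌈b * n⌉₊ → ℝ) (hcap : ∀ n, 1 ≤ n → ∀ s, 0 ≤ cap n s)
    (hgroups : ServerGroups (fun n => ⌈b * n⌉₊) cap)
    (d : ℕ → Fin K → ℕ) (hd : ∀ n, 1 ≤ n → ∀ k, d n k ≤ ⌈b * n⌉₊)
    (hdlog : ∀ k, (fun n : ℕ => Real.log n) =o[atTop] fun n => (d n k : ℝ))
    (Ω : ℕ → Type*) [∀ n, MeasurableSpace (Ω n)]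
    (P : ∀ n, Measure (Ω n)) [∀ n, IsProbabilityMeasure (P n)]
    (S : ∀ n, Fin K × Fin n → Ω n → Finset (Fin ⌈b * n⌉₊))
    (hS : ∀ n, 1 ≤ n → IsRandomAssignment (P n) (fun i => d n i.1) (S n)) :
    ∃ C : ℝ, ∀ᶠ n : ℕ in atTop, (P n).real {ω | ¬ ∀ A,
      (1 - ε) * meanRank (P n) (cap n) (S n) A ≤ clusterRank (cap n) (fun i => S n i ω) A ∧
      clusterRank (cap n) (fun i => S n i ω) A ≤ (1 + ε) * meanRank (P n) (cap n) (S n) A} ≤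
        C * (1 / (n : ℝ) ^ 2) := by
  obtain ⟨J, grp, hgrp, hbig⟩ := hgroups
  -- a common constant for the sizes of the groups
  obtain ⟨C, hC0, hC⟩ : ∃ C : ℝ, 0 < C ∧ ∀ᶠ n : ℕ in atTop, ∀ j : Fin J,
      (n : ℝ) ≤ C * ((Finset.univ.filter fun s => grp n s = j).card : ℝ) := by
    choose c hc0 hc using fun j => (hbig j).exists_pos
    refine ⟨1 + ∑ j, c j, by linarith [Finset.sum_nonneg fun j (_ : j ∈ Finset.univ) =>
      (hc0 j).le], ?_⟩
    refine eventually_all.2 fun j => ?_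
    filter_upwards [(hc j).bound] with n hn
    rw [Real.norm_of_nonneg (Nat.cast_nonneg n), Real.norm_of_nonneg (Nat.cast_nonneg _)] at hn
    refine hn.trans (mul_le_mul_of_nonneg_right ?_ (Nat.cast_nonneg _))
    linarith [Finset.single_le_sum (fun j _ => (hc0 j).le) (Finset.mem_univ j)]
  have hκ := chernoffRate_pos (δ := ε / 2) (by linarith) (by linarith)
  obtain ⟨hT1, hT2⟩ := threshold_bounds hε0 hε1
  have hT : 1 ≤ 1 + 2 / ε := by
    have : 0 < 2 / ε := by positivity
    linarith
  set κ := chernoffRate (ε / 2)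
  set T := 1 + 2 / ε
  -- for this `R`, degrees above `R log n` are large enough for the union bound
  set R := 3 * C * (b + 1) * (1 + T) / κ with hR
  have hR0 : 0 < R := by positivity
  have hdR : ∀ᶠ n : ℕ in atTop, ∀ k, R * Real.log n ≤ d n k := by
    refine eventually_all.2 fun k => ?_
    filter_upwards [(hdlog k).bound (inv_pos.2 hR0)] with n hn
    rw [Real.norm_of_nonneg (Real.log_natCast_nonneg n), Real.norm_of_nonneg (Nat.cast_nonneg _),
      ← div_eq_inv_mul, le_div_iff₀ hR0] at hn
    linarith
  refine ⟨J * (4 * K), ?_⟩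
  filter_upwards [hC, hdR, eventually_ge_atTop 2, eventually_ge_atTop K] with n hCn hdn hn2 hnK
  have hn1 : 1 ≤ n := by omega
  have hn : (0 : ℝ) < n := by exact_mod_cast hn1
  have hL : 0 < Real.log n := Real.log_pos (by exact_mod_cast hn2)
  have hm : (0 : ℝ) < (⌈b * n⌉₊ : ℝ) := by
    exact_mod_cast Nat.ceil_pos.2 (mul_pos hb hn)
  have hmn : (⌈b * n⌉₊ : ℝ) ≤ (b + 1) * n := by
    have h1 := Nat.ceil_lt_add_one (mul_pos hb hn).le
    have h2 : (1 : ℝ) ≤ n := by exact_mod_cast hn1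
    linarith
  have hdi : ∀ i : Fin K × Fin n, d n i.1 ≤ ⌈b * n⌉₊ := fun i => hd n hn1 i.1
  have hri : ∀ i : Fin K × Fin n, R * Real.log n ≤ d n i.1 := fun i => hdn i.1
  set m := ⌈b * n⌉₊
  set bad : Fin J → Set (Ω n) := fun j => {ω | ∃ A : Finset (Fin K × Fin n), A.Nonempty ∧
    A.card * (R * Real.log n) ≤ T * m ∧ ¬ IsNear (ε / 2) (fun i : Fin K × Fin n => d n i.1)
      (Finset.univ.filter fun s => grp n s = j) (fun i => S n i ω) A} with hbad
  have hsub : {ω | ¬ ∀ A,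
      (1 - ε) * meanRank (P n) (cap n) (S n) A ≤ clusterRank (cap n) (fun i => S n i ω) A ∧
      clusterRank (cap n) (fun i => S n i ω) A ≤ (1 + ε) * meanRank (P n) (cap n) (S n) A} ⊆
      ⋃ j, bad j := by
    intro ω hω
    by_contra hω'
    refine hω fun A => ?_
    rw [meanRank_eq (hS n hn1) hdi]
    refine clusterRank_near (hcap n hn1) (hgrp n hn1) fun j => ?_
    refine isNear_of_small hdi (mul_pos hR0 hL) hri (by linarith) (by linarith) hε1 hT hT1 hT2
      (fun B hB hBs => ?_) A
    by_contra hnear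
    exact hω' (Set.mem_iUnion.2 ⟨j, B, hB, hBs, hnear⟩)
  have hexp : Real.exp (-(3 * Real.log n)) = 1 / (n : ℝ) ^ 3 := by
    rw [Real.exp_neg, show 3 * Real.log n = (3 : ℕ) * Real.log n by norm_num, Real.exp_nat_mul,
      Real.exp_log hn, one_div]
  have hNy : ((K * n : ℕ) : ℝ) * (1 / (n : ℝ) ^ 3) = K * (1 / (n : ℝ) ^ 2) := by
    push_cast
    field_simp
  have hbadj : ∀ j, (P n).real (bad j) ≤ 4 * K * (1 / (n : ℝ) ^ 2) := by
    intro j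
    have h1 := measureReal_exists_not_isNear_le (hS n hn1) hdi (δ := ε / 2) (by linarith)
      (by linarith) (Finset.univ.filter fun s => grp n s = j)
      (fun A => A.card * (R * Real.log n) ≤ T * m) (y := 3 * Real.log n) fun A hA => by
        set t : ℝ := A.card * (R * Real.log n) / m with ht
        have ht0 : 0 ≤ t := by positivity
        have htT : t ≤ T := (div_le_iff₀ hm).2 hA
        have hcov : t / (1 + T) ≤ coverProb m (fun i : Fin K × Fin n => d n i.1) A := by
          refine le_trans ?_ (one_sub_exp_le_coverProb hdi hri A)
          rw [← ht]
          have h2 : Real.exp (-t) ≤ (1 + t)⁻¹ := by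
            rw [Real.exp_neg]
            exact inv_anti₀ (by linarith) (by linarith [Real.add_one_le_exp t])
          have h3 : 1 - (1 + t)⁻¹ = t / (1 + t) := by field_simp; ring
          have h4 : t / (1 + T) ≤ t / (1 + t) := by gcongr
          linarith
        have hG : (n : ℝ) / C ≤ ((Finset.univ.filter fun s => grp n s = j).card : ℝ) := by
          rw [div_le_iff₀ hC0, mul_comm]
          exact hCn j
        calc 3 * Real.log n * A.card ≤ 3 * Real.log n * A.card * ((b + 1) * n / m) := by
              refine le_mul_of_one_le_right (by positivity) ((one_le_div hm).2 hmn)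
          _ = κ * (t / (1 + T) * (n / C)) := by
              rw [ht, hR]
              field_simp
          _ ≤ _ := by
              have := coverProb_nonneg hdi A
              gcongr
    refine h1.trans ?_
    rw [hexp, Fintype.card_prod, Fintype.card_fin, Fintype.card_fin]
    have h2 := one_add_pow_sub_one_le (y := 1 / (n : ℝ) ^ 3) (by positivity) (N := K * n) (by
      rw [hNy, mul_one_div, div_le_one (by positivity)]
      have h3 : (K : ℝ) ≤ n := by exact_mod_cast hnK
      have h4 : (1 : ℝ) ≤ n := by exact_mod_cast hn1
      nlinarith)
    rw [hNy] at h2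
    linarith
  calc _ ≤ (P n).real (⋃ j, bad j) := measureReal_mono hsub (measure_ne_top _ _)
    _ ≤ ∑ j, (P n).real (bad j) := measureReal_iUnion_fintype_le _
    _ ≤ ∑ _j : Fin J, 4 * K * (1 / (n : ℝ) ^ 2) := Finset.sum_le_sum fun j _ => hbadj j
    _ = _ := by simp; ring

end PolySym

theorem theorem6
    (K : ℕ) (hK : 1 ≤ K) (b : ℝ) (hb : 0 < b) (ε : ℝ) (hε0 : 0 < ε) (hε1 : ε < 1)
    -- server capacities of the `n`-th cluster, which has `⌈b n⌉` servers
    (cap : ∀ n : ℕ, Fin ⌈b * n⌉₊ → ℝ)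
    (hcap : ∀ n, 1 ≤ n → ∀ s, 0 ≤ cap n s)
    (hgroups : PolySym.ServerGroups (fun n => ⌈b * n⌉₊) cap)
    -- degrees
    (d : ℕ → Fin K → ℕ)
    (hd : ∀ n, 1 ≤ n → ∀ k, 1 ≤ d n k ∧ d n k ≤ ⌈b * n⌉₊)
    (hdlog : ∀ k, (fun n : ℕ => Real.log n) =o[atTop] fun n => (d n k : ℝ))
    -- the random assignments; the classes of part `k` are the pairs `(k, j)`, `j < n`
    (Ω : ℕ → Type*) [∀ n, MeasurableSpace (Ω n)]
    (P : ∀ n, Measure (Ω n)) [∀ n, IsProbabilityMeasure (P n)]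
    (S : ∀ n, Fin K × Fin n → Ω n → Finset (Fin ⌈b * n⌉₊))
    (hS : ∀ n, 1 ≤ n → PolySym.IsRandomAssignment (P n) (fun i => d n i.1) (S n))
    -- arrival rates, mean service requirements, and traffic intensities per part
    (lam sig : ∀ n, Fin K × Fin n → ℝ) (ϱ : ℕ → Fin K → ℝ)
    (hlam : ∀ n, 1 ≤ n → ∀ i, 0 ≤ lam n i)
    (hsig : ∀ n, 1 ≤ n → ∀ i, 0 < sig n i)
    (hϱ : ∀ n, 1 ≤ n → ∀ i, lam n i * sig n i = ϱ n i.1)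
    (hstable : ∀ n, 1 ≤ n →
      PolySym.Stable (fun A => (1 - ε) * PolySym.meanRank (P n) (cap n) (S n) A)
        (fun i => ϱ n i.1))
    -- stationary distributions for the capacity sets `(1 + ε) 𝒞⁽ⁿ⁾` and `(1 - ε) 𝒞⁽ⁿ⁾`
    (πp πm : ∀ n, PMF (Fin K × Fin n → ℕ))
    (hπp : ∀ n, πp n = PolySym.steadyState (lam n) (sig n)
      (fun A => (1 + ε) * PolySym.meanRank (P n) (cap n) (S n) A))
    (hπm : ∀ n, πm n = PolySym.steadyState (lam n) (sig n)
      (fun A => (1 - ε) * PolySym.meanRank (P n) (cap n) (S n) A)) :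
    (fun n : ℕ => 1 - (P n).real {ω | ∀ (k : Fin K) (j : Fin n),
        πm n 0 / πp n 0 * (PolySym.partMeanJobs (πp n) k / n) ≤
          PolySym.steadyMeanJobs (lam n) (sig n)
            (PolySym.clusterRank (cap n) fun i => S n i ω) (k, j) ∧
        PolySym.steadyMeanJobs (lam n) (sig n)
            (PolySym.clusterRank (cap n) fun i => S n i ω) (k, j) ≤
          πp n 0 / πm n 0 * (PolySym.partMeanJobs (πm n) k / n)})
      =o[atTop] fun n : ℕ => 1 / (n : ℝ) := by
  obtain ⟨C, hC⟩ := PolySym.exists_eventually_measureReal_le K b hb ε hε0 hε1 cap hcap hgroups d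
    (fun n hn k => (hd n hn k).2) hdlog Ω P S hS
  have hlittle : (fun n : ℕ => C * (1 / (n : ℝ) ^ 2)) =o[atTop] fun n : ℕ => 1 / (n : ℝ) := by
    refine IsLittleO.const_mul_left ?_ C
    have h1 : (fun n : ℕ => 1 / (n : ℝ)) =o[atTop] fun _ => (1 : ℝ) :=
      (isLittleO_one_iff ℝ).2 tendsto_one_div_atTop_nhds_zero_nat
    refine (h1.mul_isBigO (isBigO_refl (fun n : ℕ => 1 / (n : ℝ)) atTop)).congr (fun n => ?_)
      fun n => one_mul _
    rw [← sq, one_div_pow]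
  refine IsBigO.trans_isLittleO (IsBigO.of_bound 1 ?_) hlittle
  filter_upwards [hC, eventually_ge_atTop 1] with n hCn hn
  have hrank : ∀ c : ℝ, 0 ≤ c →
      PolySym.IsRank fun A => c * PolySym.meanRank (P n) (cap n) (S n) A := fun c hc =>
    PolySym.isRank_mul_meanRank (hS n hn) (hcap n hn) hc
  have hρ : (fun i : Fin K × Fin n => lam n i * sig n i) = fun i => ϱ n i.1 :=
    funext fun i => hϱ n hn i
  have hst : PolySym.Stable (fun A => (1 - ε) * PolySym.meanRank (P n) (cap n) (S n) A)
      (fun i => lam n i * sig n i) := hρ ▸ hstable n hn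
  have hcl : ∀ (ω : Ω n), (∀ A,
      (1 - ε) * PolySym.meanRank (P n) (cap n) (S n) A ≤
          PolySym.clusterRank (cap n) (fun i => S n i ω) A ∧
        PolySym.clusterRank (cap n) (fun i => S n i ω) A ≤
          (1 + ε) * PolySym.meanRank (P n) (cap n) (S n) A) →
      ∀ (k : Fin K) (j : Fin n),
        πm n 0 / πp n 0 * (PolySym.partMeanJobs (πp n) k / n) ≤
          PolySym.steadyMeanJobs (lam n) (sig n)
            (PolySym.clusterRank (cap n) fun i => S n i ω) (k, j) ∧
        PolySym.steadyMeanJobs (lam n) (sig n)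
            (PolySym.clusterRank (cap n) fun i => S n i ω) (k, j) ≤
          πp n 0 / πm n 0 * (PolySym.partMeanJobs (πm n) k / n) := by
    intro ω hω k j
    have hst1 := hst.mono fun A => (hω A).1
    have hst2 := hst1.mono fun A => (hω A).2
    rw [hπp, hπm, PolySym.steadyMeanJobs, if_pos hst1,
      PolySym.partMeanJobs_div (fun k => (hd n hn k).2) (hS n hn) (hcap n hn) (by linarith)
        (hlam n hn) (hsig n hn) (hϱ n hn) hst2 k j,
      PolySym.partMeanJobs_div (fun k => (hd n hn k).2) (hS n hn) (hcap n hn) (by linarith)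
        (hlam n hn) (hsig n hn) (hϱ n hn) hst k j]
    exact PolySym.meanJobs_mem_of_le_of_le (hrank (1 - ε) (by linarith))
      (PolySym.isRank_clusterRank (hcap n hn) _) (hrank (1 + ε) (by linarith))
      (fun A => (hω A).1) (fun A => (hω A).2) (hlam n hn) (hsig n hn) hst (k, j)
  set good : Set (Ω n) := {ω | ∀ (k : Fin K) (j : Fin n),
        πm n 0 / πp n 0 * (PolySym.partMeanJobs (πp n) k / n) ≤
          PolySym.steadyMeanJobs (lam n) (sig n)
            (PolySym.clusterRank (cap n) fun i => S n i ω) (k, j) ∧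
        PolySym.steadyMeanJobs (lam n) (sig n)
            (PolySym.clusterRank (cap n) fun i => S n i ω) (k, j) ≤
          πp n 0 / πm n 0 * (PolySym.partMeanJobs (πm n) k / n)}
  have hle : (P n).real good ≤ 1 := measureReal_le_one
  have hcover : (1 : ℝ) ≤ (P n).real good + C * (1 / (n : ℝ) ^ 2) := by
    refine le_trans ?_ (add_le_add_right hCn _)
    refine le_trans ?_ (measureReal_union_le _ _)
    refine (probReal_univ (μ := P n)).ge.trans ?_
    refine measureReal_mono (fun ω _ => ?_) (measure_ne_top _ _)
    by_cases h : ω ∈ good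
    · exact Or.inl h
    · exact Or.inr fun h' => h (hcl ω h')
  rw [one_mul, Real.norm_of_nonneg (sub_nonneg.2 hle), Real.norm_eq_abs]
  exact le_trans (by linarith) (le_abs_self _)
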